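/- Let $\mathbb F$ be a field of characteristic $\ne 2$. An anticommutative algebra $\mathbf A$ over $\mathbb F$ with product $[\cdot,\cdot]$ and Jacobian $\mathcal J(x,y,z)=[[x,y],z]+[[y,z],x]+[[z,x],y]$ is a Lie algebra if $\mathcal J=0$, a Malcev algebra if $\mathcal J(x,y,[x,z])=[\mathcal J(x,y,z),x]$ for all $x,y,z$, and a binary Lie algebra if $\mathcal J([x,y],x,y)=0$ for all $x,y$. It is nilpotent if $\mathbf A^n=0$ for some $n\ge1$, where $\mathbf A^1=\mathbf A$ and $\mathbf A^{n+1}=\sum_{i=1}^{n}[\mathbf A^{n+1-i},\mathbf A^{i}]$. Put $\mathrm{Ann}(\mathbf A)=\{x:[x,\mathbf A]=0\}$. Let $\mathrm Z^2_{BL}(\mathbf A,\mathbb F)$ be the space of skew-symmetric bilinear forms $\theta:\mathbf A\times\mathbf A\to\mathbb F$ with $\theta([[x,y],x],y)=\theta([[x,y],y],x)$ for all $x,y$; let $\mathrm Z^2_{M}(\mathbf A,\mathbb F)$ be its subspace of those $\theta$ with $$\theta([w,y],[x,z])=\theta([[w,x],y],z)+\theta([[x,y],z],w)+\theta([[y,z],w],x)+\theta([[z,w],x],y)\quad\text{for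 all }x,y,z,w;$$ let $\mathrm B^2(\mathbf A,\mathbb F)$ be the space of the forms $(x,y)\mapsto f([x,y])$, $f:\mathbf A\to\mathbb F$ linear; and put $\mathrm H^2_{BL}=\mathrm Z^2_{BL}/\mathrm B^2\supseteq \mathrm H^2_{M}=\mathrm Z^2_{M}/\mathrm B^2$. For $s\ge 1$ let $\mathbf U_s(\mathbf A)$ be the set of the $s$-dimensional subspaces $\langle[\theta_1],\dots,[\theta_s]\rangle$ of $\mathrm H^2_{BL}(\mathbf A,\mathbb F)$ that are not contained in $\mathrm H^2_M(\mathbf A,\mathbb F)$ and satisfy $\theta_1^\perp\cap\dots\cap\theta_s^\perp\cap\mathrm{Ann}(\mathbf A)=0$, where $\theta^\perp=\{x:\theta(x,\mathbf A)=0\}$. Consider the following anticommutative algebras with basis $e_1,\dots,e_5$ (only the nonzero products $[e_i,e_j]$, $i<j$, are given). Let $\Delta_{ij}$ be the skew-symmetric form with $\Delta_{ij}(e_i,e_j)=1=-\Delta_{ij}(e_j,e_i)$ that vanishes on all other pairs of basis vectors. | $\mathbf A$ | products | cocycles (representatives) | $\mathrm{Ann}(\mathbf A)$ | |---|---|---|---|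 | $L_{5,1}$ | none | $\Delta_{ij}$, $1\le i<j\le5$ | $L_{5,1}$ | | $L_{5,2}$ | $[e_1,e_2]=e_3$ | $\Delta_{13},\Delta_{14},\Delta_{23},\Delta_{24},\Delta_{34},\Delta_{15},\Delta_{25},\Delta_{35},\Delta_{45}$ | $\langle e_3,e_4,e_5\rangle$ | | $L_{5,3}$ | $[e_1,e_2]=e_3,\ [e_1,e_3]=e_4$ | $\Delta_{14},\Delta_{23},\Delta_{15},\Delta_{25},\Delta_{35}$ | $\langle e_4,e_5\rangle$ | | $L_{5,4}$ | $[e_1,e_2]=e_5,\ [e_3,e_4]=e_5$ | $\Delta_{13},\Delta_{14},\Delta_{23},\Delta_{24},\Delta_{34},\Delta_{15},\Delta_{25},\Delta_{35},\Delta_{45}$ | $\langle e_5\rangle$ | | $L_{5,5}$ | $[e_1,e_2]=e_3,\ [e_1,e_3]=e_5,\ [e_2,e_4]=e_5$ | $\Delta_{13},\Delta_{14},\Delta_{23},\Delta_{34},\Delta_{15}$ | $\langle e_5\rangle$ | | $L_{5,6}$ | $[e_1,e_2]=e_3,\ [e_1,e_3]=e_4,\ [e_1,e_4]=e_5,\ [e_2,e_3]=e_5$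 | $\Delta_{14},\ \Delta_{15}+\Delta_{24},\ \Delta_{25}-\Delta_{34}$ | $\langle e_5\rangle$ | | $L_{5,7}$ | $[e_1,e_2]=e_3,\ [e_1,e_3]=e_4,\ [e_1,e_4]=e_5$ | $\Delta_{15},\ \Delta_{23},\ \Delta_{25}-\Delta_{34}$ | $\langle e_5\rangle$ | | $L_{5,8}$ | $[e_1,e_2]=e_4,\ [e_1,e_3]=e_5$ | $\Delta_{14},\Delta_{15},\Delta_{23},\Delta_{24},\Delta_{34},\Delta_{25},\Delta_{35}$ | $\langle e_4,e_5\rangle$ | | $L_{5,9}$ | $[e_1,e_2]=e_3,\ [e_1,e_3]=e_4,\ [e_2,e_3]=e_5$ | $\Delta_{14},\ \Delta_{15}+\Delta_{24},\ \Delta_{25}$ | $\langle e_4,e_5\rangle$ | | $M_{5,1}$ | $[e_1,e_2]=e_3,\ [e_3,e_4]=e_5$ | $\Delta_{13},\Delta_{14},\Delta_{23},\Delta_{24}$ | $\langle e_5\rangle$ | Theorem. Every $5$-dimensional nilpotent binary Lie algebra over $\mathbb F$ is a Malcev algebra and is isomorphic to exactly one of the ten algebras $L_{5,1},\dots,L_{5,9},M_{5,1}$.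 These ten algebras are themselves nilpotent Malcev algebras (hence binary Lie) and pairwise nonisomorphic; $L_{5,1},\dots,L_{5,9}$ are Lie algebras and $M_{5,1}$ is not. For each of them, $\mathrm B^2\subseteq\mathrm Z^2_M$, the classes of the cocycles in its row form a basis of $\mathrm H^2_M(\mathbf A,\mathbb F)$, and $\mathrm{Ann}(\mathbf A)$ is as listed. Moreover $\mathrm H^2_{BL}(\mathbf A,\mathbb F)=\mathrm H^2_M(\mathbf A,\mathbb F)$ for $\mathbf A=L_{5,1},\dots,L_{5,7},L_{5,9}$, and $\mathrm H^2_{BL}(\mathbf A,\mathbb F)=\mathrm H^2_M(\mathbf A,\mathbb F)\oplus\langle[\Delta_{45}]\rangle$ with $[\Delta_{45}]\ne0$ for $\mathbf A=L_{5,8}$ and $\mathbf A=M_{5,1}$. Finally, $\mathbf U_1(\mathbf A)\neq\emptyset$ for $\mathbf A=L_{5,8}$ and $\mathbf A=M_{5,1}$, and $\mathbf U_1(L_{5,i})=\emptyset$ for $i\in\{1,2,3,4,5,6,7,9\}$. -/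

import Mathlib

-- the value that Mathlib itself is built with
set_option maxSynthPendingDepth 3

namespace NilpBL

universe u v w

/-! An algebra over `F` is an `F`-vector space `A` together with a bilinear product
`μ : A →ₗ[F] A →ₗ[F] A`, written `[x, y] = μ x y`. -/

section Algebras

variable {F : Type u} [Field F] {A : Type v} [AddCommGroup A] [Module F A]
  {B : Type w} [AddCommGroup B] [Module F B]

/-- The Jacobian `J(x,y,z) = [[x,y],z] + [[y,z],x] + [[z,x],y]`. -/
def jacobian (μ : A →ₗ[F] A →ₗ[F] A) (x y z : A) : A :=
  μ (μ x y) z + μ (μ y z) x + μ (μ z x) y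

/-- Anticommutativity: `[x,y] = -[y,x]`. -/
def IsAnticommutative (μ : A →ₗ[F] A →ₗ[F] A) : Prop :=
  ∀ x y, μ x y = -μ y x

/-- Lie algebras. -/
def IsLie (μ : A →ₗ[F] A →ₗ[F] A) : Prop :=
  IsAnticommutative μ ∧ ∀ x y z, jacobian μ x y z = 0

/-- Malcev algebras: `J(x,y,[x,z]) = [J(x,y,z),x]`. -/
def IsMalcev (μ : A →ₗ[F] A →ₗ[F] A) : Prop :=
  IsAnticommutative μ ∧ ∀ x y z, jacobian μ x y (μ x z) = μ (jacobian μ x y z) x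

/-- Binary Lie algebras: `J([x,y],x,y) = 0`. -/
def IsBinaryLie (μ : A →ₗ[F] A →ₗ[F] A) : Prop :=
  IsAnticommutative μ ∧ ∀ x y, jacobian μ (μ x y) x y = 0

/-- The powers `A¹ = A`, `Aⁿ⁺¹ = [Aⁿ,A¹] + [Aⁿ⁻¹,A²] + ⋯ + [A¹,Aⁿ]`, where `[P,Q]` is the span of
the products `[p,q]`. The value at `0` is a dummy. -/
def power (μ : A →ₗ[F] A →ₗ[F] A) : ℕ → Submodule F A
  | 0 => ⊤
  | 1 => ⊤
  | n + 2 => ⨆ i : Fin (n + 1), Submodule.map₂ μ (power μ (n + 1 - i)) (power μ (i + 1))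
decreasing_by all_goals omega

/-- Nilpotency: `Aⁿ = 0` for some `n ≥ 1`. -/
def IsNilpotentAlg (μ : A →ₗ[F] A →ₗ[F] A) : Prop :=
  ∃ n : ℕ, 1 ≤ n ∧ power μ n = ⊥

/-- Isomorphism of algebras. -/
def Isomorphic (μ : A →ₗ[F] A →ₗ[F] A) (ν : B →ₗ[F] B →ₗ[F] B) : Prop :=
  ∃ e : A ≃ₗ[F] B, ∀ x y, e (μ x y) = ν (e x) (e y)

/-- The annihilator `{x | [x, A] = 0}`. -/
def Ann (μ : A →ₗ[F] A →ₗ[F] A) : Submodule F A := LinearMap.ker μ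

/-- `Z²_BL(A,F)`: the skew-symmetric bilinear forms `θ` with `θ([[x,y],x],y) = θ([[x,y],y],x)`. -/
def ZBL (μ : A →ₗ[F] A →ₗ[F] A) : Submodule F (A →ₗ[F] A →ₗ[F] F) where
  carrier := {θ | (∀ x y, θ x y = -θ y x) ∧
    ∀ x y, θ (μ (μ x y) x) y = θ (μ (μ x y) y) x}
  zero_mem' := by simp
  add_mem' := by
    rintro θ η ⟨h1, h2⟩ ⟨h3, h4⟩
    refine ⟨fun x y => ?_, fun x y => ?_⟩
    · simp only [LinearMap.add_apply]
      rw [h1 x y, h3 x y]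
      abel
    · simp only [LinearMap.add_apply]
      rw [h2 x y, h4 x y]
  smul_mem' := by
    rintro c θ ⟨h1, h2⟩
    refine ⟨fun x y => ?_, fun x y => ?_⟩
    · simp only [LinearMap.smul_apply]
      rw [h1 x y, smul_neg]
    · simp only [LinearMap.smul_apply]
      rw [h2 x y]

/-- `Z²_M(A,F)`: the `θ` in `Z²_BL(A,F)` with `θ([w,y],[x,z]) = θ([[w,x],y],z) + θ([[x,y],z],w) +
θ([[y,z],w],x) + θ([[z,w],x],y)`. -/
def ZM (μ : A →ₗ[F] A →ₗ[F] A) : Submodule F (A →ₗ[F] A →ₗ[F] F) where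
  carrier := {θ | θ ∈ ZBL μ ∧ ∀ x y z w, θ (μ w y) (μ x z) =
    θ (μ (μ w x) y) z + θ (μ (μ x y) z) w + θ (μ (μ y z) w) x + θ (μ (μ z w) x) y}
  zero_mem' := ⟨zero_mem _, by simp⟩
  add_mem' := by
    rintro θ η ⟨h1, h2⟩ ⟨h3, h4⟩
    refine ⟨add_mem h1 h3, fun x y z w => ?_⟩
    simp only [LinearMap.add_apply]
    rw [h2 x y z w, h4 x y z w]
    abel
  smul_mem' := by
    rintro c θ ⟨h1, h2⟩
    refine ⟨Submodule.smul_mem _ c h1, fun x y z w => ?_⟩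
    simp only [LinearMap.smul_apply]
    rw [h2 x y z w]
    simp only [smul_add]

/-- The linear map `f ↦ δf`, where `δf(x,y) = f([x,y])`. -/
def coboundary (μ : A →ₗ[F] A →ₗ[F] A) : (A →ₗ[F] F) →ₗ[F] (A →ₗ[F] A →ₗ[F] F) where
  toFun f := μ.compr₂ f
  map_add' _ _ := rfl
  map_smul' _ _ := rfl

/-- `B²(A,F) = {δf}`. -/
def B2 (μ : A →ₗ[F] A →ₗ[F] A) : Submodule F (A →ₗ[F] A →ₗ[F] F) :=
  LinearMap.range (coboundary μ)

/-- In characteristic not `2`, coboundaries of a binary Lie algebra are cocycles. -/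
theorem B2_le_ZBL (hF : ringChar F ≠ 2) {μ : A →ₗ[F] A →ₗ[F] A} (h : IsBinaryLie μ) :
    B2 μ ≤ ZBL μ := by
  rintro _ ⟨f, rfl⟩
  refine ⟨fun x y => ?_, fun x y => ?_⟩
  · change f (μ x y) = -f (μ y x)
    rw [h.1 x y, map_neg]
  · change f (μ (μ (μ x y) x) y) = f (μ (μ (μ x y) y) x)
    have h0 : μ (μ x y) (μ x y) = 0 := by
      have h2 : (2 : F) • μ (μ x y) (μ x y) = 0 := by
        rw [two_smul]
        nth_rewrite 1 [h.1 (μ x y) (μ x y)]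
        exact neg_add_cancel _
      exact (smul_eq_zero.mp h2).resolve_left (Ring.two_ne_zero hF)
    have h1 := h.2 x y
    rw [jacobian, h0, add_zero, h.1 y (μ x y), map_neg, LinearMap.neg_apply] at h1
    rw [add_neg_eq_zero.mp h1]

/-- `H²_BL(A,F) = Z²_BL(A,F) / B²(A,F)`. -/
abbrev H2BL (μ : A →ₗ[F] A →ₗ[F] A) : Type _ :=
  ↥(ZBL μ) ⧸ (B2 μ).submoduleOf (ZBL μ)

/-- The class `[θ]` in `H²_BL(A,F)` of a cocycle `θ`. -/
def cls (μ : A →ₗ[F] A →ₗ[F] A) : ↥(ZBL μ) →ₗ[F] H2BL μ :=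
  ((B2 μ).submoduleOf (ZBL μ)).mkQ

/-- `H²_M(A,F) = Z²_M(A,F) / B²(A,F)`, as a subspace of `H²_BL(A,F)`. -/
def H2M (μ : A →ₗ[F] A →ₗ[F] A) : Submodule F (H2BL μ) :=
  ((ZM μ).submoduleOf (ZBL μ)).map (cls μ)

/-- The classes of the bilinear forms in the list `l`, which are cocycles, form a basis of the
subspace `W` of `H²_BL(A,F)`. -/
def IsClassBasis (μ : A →ₗ[F] A →ₗ[F] A) (l : List (A →ₗ[F] A →ₗ[F] F))
    (W : Submodule F (H2BL μ)) : Prop :=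
  ∃ z : Fin l.length → ↥(ZBL μ), (∀ i, (z i : A →ₗ[F] A →ₗ[F] F) = l.get i) ∧
    LinearIndependent F (fun i => cls μ (z i)) ∧
    Submodule.span F (Set.range fun i => cls μ (z i)) = W

/-- The annihilator `θ^⊥ = {x | θ(x, A) = 0}` of a bilinear form. -/
def perp (θ : A →ₗ[F] A →ₗ[F] F) : Submodule F A := LinearMap.ker θ

/-- `T_s(A)`: the `s`-dimensional subspaces `⟨[θ₁],…,[θ_s]⟩` of `H²_BL(A,F)` such that
`θ₁^⊥ ∩ ⋯ ∩ θ_s^⊥ ∩ Ann(A) = 0`. -/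
def T (μ : A →ₗ[F] A →ₗ[F] A) (s : ℕ) : Set (Submodule F (H2BL μ)) :=
  {W | Module.finrank F W = s ∧ ∃ θ : Fin s → ↥(ZBL μ),
    W = Submodule.span F (Set.range fun i => cls μ (θ i)) ∧
    (⨅ i, perp (θ i : A →ₗ[F] A →ₗ[F] F)) ⊓ Ann μ = ⊥}

/-- `U_s(A)`: the members of `T_s(A)` that are not contained in `H²_M(A,F)`. -/
def U (μ : A →ₗ[F] A →ₗ[F] A) (s : ℕ) : Set (Submodule F (H2BL μ)) :=
  {W | W ∈ T μ s ∧ ¬ W ≤ H2M μ}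

end Algebras

section Tables

variable (F : Type u) [Field F]

/-- The bilinear form `Δ` with `Δ(x,y) = x_i y_j - x_j y_i` on `F⁵`. Indices run from `0` to `4`,
so `delta F 0 1` is the form written `Δ₁₂`. -/
def delta (i j : Fin 5) : (Fin 5 → F) →ₗ[F] (Fin 5 → F) →ₗ[F] F :=
  LinearMap.mk₂ F (fun x y => x i * y j - x j * y i)
    (fun x x' y => by simp only [Pi.add_apply]; ring)
    (fun c x y => by simp only [Pi.smul_apply, smul_eq_mul]; ring)
    (fun x y y' => by simp only [Pi.add_apply]; ring)
    (fun c x y => by simp only [Pi.smul_apply, smul_eq_mul]; ring)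

/-- The basis vectors of `F⁵`; `e F 0` is the vector written `e₁`. -/
def e (k : Fin 5) : Fin 5 → F := Pi.single k 1

/-- The product with `[e_i,e_j] = -[e_j,e_i] = e_k` as its only nonzero products of basis
vectors (for `i ≠ j`). -/
def br (i j k : Fin 5) : (Fin 5 → F) →ₗ[F] (Fin 5 → F) →ₗ[F] (Fin 5 → F) :=
  (delta F i j).compr₂ (LinearMap.toSpanSingleton F (Fin 5 → F) (e F k))

/-- The names of the ten algebras `L_{5,1}, …, L_{5,9}, M_{5,1}`. -/
inductive Name : Type
  | L51 | L52 | L53 | L54 | L55 | L56 | L57 | L58 | L59 | M51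

/-- The products of the ten algebras, all on `F⁵`. Indices are shifted by one: `br F 0 1 2`
contributes `[e₁,e₂] = e₃`. -/
def table : Name → ((Fin 5 → F) →ₗ[F] (Fin 5 → F) →ₗ[F] (Fin 5 → F))
  | .L51 => 0
  | .L52 => br F 0 1 2
  | .L53 => br F 0 1 2 + br F 0 2 3
  | .L54 => br F 0 1 4 + br F 2 3 4
  | .L55 => br F 0 1 2 + br F 0 2 4 + br F 1 3 4
  | .L56 => br F 0 1 2 + br F 0 2 3 + br F 0 3 4 + br F 1 2 4
  | .L57 => br F 0 1 2 + br F 0 2 3 + br F 0 3 4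
  | .L58 => br F 0 1 3 + br F 0 2 4
  | .L59 => br F 0 1 2 + br F 0 2 3 + br F 1 2 4
  | .M51 => br F 0 1 2 + br F 2 3 4

/-- The listed cocycles, whose classes are the generators of `H²_M(-,F)` in the table. -/
def tableH2M : Name → List ((Fin 5 → F) →ₗ[F] (Fin 5 → F) →ₗ[F] F)
  | .L51 => [delta F 0 1, delta F 0 2, delta F 0 3, delta F 1 2, delta F 1 3, delta F 2 3,
      delta F 0 4, delta F 1 4, delta F 2 4, delta F 3 4]
  | .L52 => [delta F 0 2, delta F 0 3, delta F 1 2, delta F 1 3, delta F 2 3,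
      delta F 0 4, delta F 1 4, delta F 2 4, delta F 3 4]
  | .L53 => [delta F 0 3, delta F 1 2, delta F 0 4, delta F 1 4, delta F 2 4]
  | .L54 => [delta F 0 2, delta F 0 3, delta F 1 2, delta F 1 3, delta F 2 3,
      delta F 0 4, delta F 1 4, delta F 2 4, delta F 3 4]
  | .L55 => [delta F 0 2, delta F 0 3, delta F 1 2, delta F 2 3, delta F 0 4]
  | .L56 => [delta F 0 3, delta F 0 4 + delta F 1 3, delta F 1 4 - delta F 2 3]
  | .L57 => [delta F 0 4, delta F 1 2, delta F 1 4 - delta F 2 3]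
  | .L58 => [delta F 0 3, delta F 0 4, delta F 1 2, delta F 1 3, delta F 2 3, delta F 1 4,
      delta F 2 4]
  | .L59 => [delta F 0 3, delta F 0 4 + delta F 1 3, delta F 1 4]
  | .M51 => [delta F 0 2, delta F 0 3, delta F 1 2, delta F 1 3]

/-- The listed annihilators. -/
def tableAnn : Name → Submodule F (Fin 5 → F)
  | .L51 => ⊤
  | .L52 => Submodule.span F {e F 2, e F 3, e F 4}
  | .L53 => Submodule.span F {e F 3, e F 4}
  | .L54 => Submodule.span F {e F 4}
  | .L55 => Submodule.span F {e F 4}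
  | .L56 => Submodule.span F {e F 4}
  | .L57 => Submodule.span F {e F 4}
  | .L58 => Submodule.span F {e F 3, e F 4}
  | .L59 => Submodule.span F {e F 3, e F 4}
  | .M51 => Submodule.span F {e F 4}

end Tables

end NilpBL

/-! The classification proceeds by central extensions, one dimension at a time. A nonzero nilpotent
algebra has a central element `z ≠ 0`, and the quotient by its line is again anticommutative and
nilpotent. Climbing from dimension two gives the normal forms in dimension four (`isNormalFour`);
anticommutativity and nilpotency suffice there.

In dimension five, lift such a basis of the quotient: the products of the lifts are known up to
multiples of `z`, and a change of basis normalises these multiples. Over an abelian quotient this is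
the classification of an alternating form on a 4-space (`inTable_of_abelian`); over the sum of a
Heisenberg algebra and a line it is an elimination steered by which multiples vanish
(`inTable_of_heisenberg`). Over the filiform quotient (`inTable_of_filiform`) the binary Lie
identity is needed, to kill two products; nowhere else is it used. All resulting algebras are in the
table, so the Malcev property is transported from there.

The ten algebras are separated by the dimensions of the annihilators of `A` and of `[A,A]`, by being
Lie or not, and by the vanishing of `[x,[y,[z,w]]]`.

For the cohomology, a skew form is written in its ten coordinates. The binary Lie condition,
evaluated at a few vectors, leaves only coboundaries, the listed cocycles and, for `L58` and `M51`,
the form `Δ₄₅` (`span_of_ZBL`). The Malcev condition removes exactly `Δ₄₅` (`ZM_apply_eq_zero`),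
whose class then spans the complement and the line needed for `U`. -/

namespace NilpBL

universe u v w

/-! ### The ten algebras in coordinates: identities and nilpotency -/

section TableAlgebras

variable (F : Type u) [Field F]

theorem delta_apply (i j : Fin 5) (x y : Fin 5 → F) :
    delta F i j x y = x i * y j - x j * y i := rfl

theorem br_apply (i j k : Fin 5) (x y : Fin 5 → F) :
    br F i j k x y = Pi.single k (x i * y j - x j * y i) := by
  change (x i * y j - x j * y i) • Pi.single k (1 : F) = _
  rw [← Pi.single_smul]
  simp

/-- The products of the table in coordinates. -/
def tableVec : Name → (Fin 5 → F) → (Fin 5 → F) → (Fin 5 → F)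
  | .L51, _, _ => ![0, 0, 0, 0, 0]
  | .L52, x, y => ![0, 0, x 0 * y 1 - x 1 * y 0, 0, 0]
  | .L53, x, y => ![0, 0, x 0 * y 1 - x 1 * y 0, x 0 * y 2 - x 2 * y 0, 0]
  | .L54, x, y => ![0, 0, 0, 0, (x 0 * y 1 - x 1 * y 0) + (x 2 * y 3 - x 3 * y 2)]
  | .L55, x, y => ![0, 0, x 0 * y 1 - x 1 * y 0, 0,
      (x 0 * y 2 - x 2 * y 0) + (x 1 * y 3 - x 3 * y 1)]
  | .L56, x, y => ![0, 0, x 0 * y 1 - x 1 * y 0, x 0 * y 2 - x 2 * y 0,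
      (x 0 * y 3 - x 3 * y 0) + (x 1 * y 2 - x 2 * y 1)]
  | .L57, x, y => ![0, 0, x 0 * y 1 - x 1 * y 0, x 0 * y 2 - x 2 * y 0, x 0 * y 3 - x 3 * y 0]
  | .L58, x, y => ![0, 0, 0, x 0 * y 1 - x 1 * y 0, x 0 * y 2 - x 2 * y 0]
  | .L59, x, y => ![0, 0, x 0 * y 1 - x 1 * y 0, x 0 * y 2 - x 2 * y 0, x 1 * y 2 - x 2 * y 1]
  | .M51, x, y => ![0, 0, x 0 * y 1 - x 1 * y 0, 0, x 2 * y 3 - x 3 * y 2]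

theorem table_apply (t : Name) (x y : Fin 5 → F) : table F t x y = tableVec F t x y := by
  cases t <;> ext i <;> fin_cases i <;> simp [table, br_apply, tableVec]

theorem table_anticomm (t : Name) : IsAnticommutative (table F t) := by
  intro x y
  simp only [table_apply]
  cases t <;> ext i <;> fin_cases i <;> simp [tableVec] <;> ring

theorem table_isLie (t : Name) (ht : t ≠ .M51) : IsLie (table F t) := by
  refine ⟨table_anticomm F t, fun x y z => ?_⟩
  simp only [jacobian, table_apply]
  cases t <;> first | exact absurd rfl ht | (ext i; fin_cases i <;> simp [tableVec] <;> ring)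

theorem table_M51_not_isLie : ¬ IsLie (table F .M51) := by
  intro h
  have := congrFun (h.2 (e F 0) (e F 1) (e F 3)) 4
  simp [jacobian, table_apply, tableVec, e] at this

theorem IsLie.isMalcev {A : Type v} [AddCommGroup A] [Module F A] {μ : A →ₗ[F] A →ₗ[F] A}
    (h : IsLie μ) : IsMalcev μ :=
  ⟨h.1, fun _ _ _ => by rw [h.2, h.2, map_zero, LinearMap.zero_apply]⟩

theorem IsLie.isBinaryLie {A : Type v} [AddCommGroup A] [Module F A] {μ : A →ₗ[F] A →ₗ[F] A}
    (h : IsLie μ) : IsBinaryLie μ :=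
  ⟨h.1, fun _ _ => h.2 _ _ _⟩

theorem table_isMalcev (t : Name) : IsMalcev (table F t) := by
  by_cases ht : t = .M51
  · subst ht
    -- Jacobians lie on the central line of `e₅`, and a Jacobian with an argument in `[A,A] =
    -- ⟨e₃,e₅⟩` is zero, so both sides vanish.
    refine ⟨table_anticomm F _, fun x y z => ?_⟩
    simp only [jacobian, table_apply]
    ext i; fin_cases i <;> simp [tableVec]
  · exact IsLie.isMalcev F (table_isLie F t ht)

theorem table_isBinaryLie (t : Name) : IsBinaryLie (table F t) := by
  by_cases ht : t = .M51
  · subst ht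
    refine ⟨table_anticomm F _, fun x y => ?_⟩
    simp only [jacobian, table_apply]
    ext i; fin_cases i <;> simp [tableVec]
  · exact IsLie.isBinaryLie F (table_isLie F t ht)

/-- The vectors of `F⁵` whose first `k` coordinates vanish. -/
def tail (k : ℕ) : Submodule F (Fin 5 → F) where
  carrier := {x | ∀ i : Fin 5, i.val < k → x i = 0}
  zero_mem' := fun _ _ => rfl
  add_mem' hx hy i hi := by rw [Pi.add_apply, hx i hi, hy i hi, add_zero]
  smul_mem' c x hx i hi := by rw [Pi.smul_apply, hx i hi, smul_zero]

/-- Structure constants that strictly raise the index push the filtration by `tail` one step down.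
-/
theorem br_mem_tail {i j l : Fin 5} (hi : i < l) (hj : j < l) {k : ℕ} {x : Fin 5 → F}
    (hx : x ∈ tail F k) (y : Fin 5 → F) : br F i j l x y ∈ tail F (k + 1) := by
  intro m hm
  rw [br_apply]
  by_cases h : m = l
  · subst h
    rw [Pi.single_eq_same, hx i (by omega), hx j (by omega)]
    simp
  · rw [Pi.single_eq_of_ne h]

theorem table_mem_tail (t : Name) {k : ℕ} {x : Fin 5 → F} (hx : x ∈ tail F k) (y : Fin 5 → F) :
    table F t x y ∈ tail F (k + 1) := by
  cases t <;> simp only [table, LinearMap.add_apply] <;>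
    repeat first
      | exact zero_mem _
      | exact br_mem_tail F (by decide) (by decide) hx y
      | refine add_mem ?_ ?_

/-- In a product whose degrees add up to at least `2 ^ (k + 1)`, one factor has degree at least `2 ^
k`. This crude bound avoids comparing `power` with left-normed powers, and `2 ^ 5 = 32` already
reaches `tail F 5 = 0`. -/
theorem power_table_le (t : Name) (k : ℕ) : ∀ n, 2 ^ k ≤ n → power (table F t) n ≤ tail F k := by
  induction k with
  | zero => intro n _ x _ i hi; omega
  | succ k ih =>
    intro n hn
    have h2 : 2 ^ (k + 1) = 2 ^ k + 2 ^ k := by ring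
    have h1 : 1 ≤ 2 ^ k := Nat.one_le_two_pow
    obtain ⟨n, rfl⟩ : ∃ m, n = m + 2 := ⟨n - 2, by omega⟩
    rw [power]
    refine iSup_le fun i => Submodule.map₂_le.2 fun x hx y hy => ?_
    by_cases h : 2 ^ k ≤ n + 1 - i
    · exact table_mem_tail F t (ih _ h hx) y
    · rw [table_anticomm F t x y]
      exact neg_mem (table_mem_tail F t (ih (i + 1) (by omega) hy) x)

theorem table_isNilpotent (t : Name) : IsNilpotentAlg (table F t) := by
  refine ⟨32, by norm_num, ?_⟩
  rw [eq_bot_iff]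
  refine (power_table_le F t 5 32 (by norm_num)).trans fun x hx => ?_
  rw [Submodule.mem_bot]
  exact funext fun i => hx i i.isLt

end TableAlgebras

/-! ### Bases of cohomology classes and membership in `H2M` -/

section Cohomology

variable {F : Type u} [Field F] {A : Type v} [AddCommGroup A] [Module F A]

/-- A criterion for the classes of a list of cocycles to be a basis of `H²_M`. -/
theorem isClassBasis_of {μ : A →ₗ[F] A →ₗ[F] A} {l : List (A →ₗ[F] A →ₗ[F] F)}
    (hl : ∀ i, l.get i ∈ ZM μ)
    (hind : ∀ (c : Fin l.length → F) (f : A →ₗ[F] F),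
      ∑ i, c i • l.get i = coboundary μ f → c = 0)
    (hspan : ∀ θ ∈ ZM μ, ∃ f : A →ₗ[F] F, θ - coboundary μ f ∈ Submodule.span F {x | x ∈ l}) :
    IsClassBasis μ l (H2M μ) := by
  refine ⟨fun i => ⟨l.get i, (hl i).1⟩, fun i => rfl, ?_, ?_⟩
  · rw [Fintype.linearIndependent_iff]
    intro c hc
    have h : cls μ (∑ i, c i • (⟨l.get i, (hl i).1⟩ : ↥(ZBL μ))) = 0 := by
      simpa only [map_sum, map_smul] using hc
    rw [cls, Submodule.mkQ_apply, Submodule.Quotient.mk_eq_zero] at h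
    obtain ⟨f, hf⟩ := h
    have h2 := hind c f (by rw [hf]; simp [Submodule.subtype_apply])
    exact fun i => congrFun h2 i
  · apply le_antisymm
    · rw [Submodule.span_le]
      rintro _ ⟨i, rfl⟩
      exact ⟨⟨l.get i, (hl i).1⟩, hl i, rfl⟩
    · rintro _ ⟨θ, hθ, rfl⟩
      obtain ⟨f, h⟩ := hspan θ.1 hθ
      rw [← Set.range_list_get, Submodule.mem_span_range_iff_exists_fun] at h
      obtain ⟨c, h⟩ := h
      have h2 : cls μ θ = cls μ (∑ i, c i • (⟨l.get i, (hl i).1⟩ : ↥(ZBL μ))) := by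
        rw [cls, Submodule.mkQ_apply, Submodule.mkQ_apply, Submodule.Quotient.eq]
        refine ⟨f, ?_⟩
        have h3 : θ.1 = ∑ i, c i • l.get i + coboundary μ f := by
          rw [h, sub_add_cancel]
        change _ = (θ - ∑ i, c i • (⟨l.get i, (hl i).1⟩ : ↥(ZBL μ)) : ↥(ZBL μ)).1
        rw [Submodule.coe_sub, h3]
        simp
      rw [h2, map_sum]
      refine Submodule.sum_mem _ fun i _ => ?_
      rw [map_smul]
      exact Submodule.smul_mem _ _ (Submodule.subset_span ⟨i, rfl⟩)

theorem cls_surjective (μ : A →ₗ[F] A →ₗ[F] A) : Function.Surjective (cls μ) :=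
  Submodule.mkQ_surjective _

theorem H2M_eq_top {μ : A →ₗ[F] A →ₗ[F] A} (h : ZBL μ ≤ ZM μ) : H2M μ = ⊤ := by
  rw [eq_top_iff]
  intro x _
  obtain ⟨θ, rfl⟩ := cls_surjective μ x
  exact ⟨θ, h θ.2, rfl⟩

/-- Two representatives of a class differ by a coboundary, which is itself a Malcev cocycle, so the
test may be made on any representative. -/
theorem cls_mem_H2M {μ : A →ₗ[F] A →ₗ[F] A} (hB : B2 μ ≤ ZM μ) (θ : ↥(ZBL μ)) :
    cls μ θ ∈ H2M μ ↔ θ.1 ∈ ZM μ := by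
  refine ⟨?_, fun h => ⟨θ, h, rfl⟩⟩
  rintro ⟨η, hη, h⟩
  rw [cls, Submodule.mkQ_apply, Submodule.mkQ_apply, Submodule.Quotient.eq] at h
  have := sub_mem (show η.1 ∈ ZM μ from hη) (hB (show η.1 - θ.1 ∈ B2 μ from h))
  simpa using this

end Cohomology

/-! ### Cocycles of the ten algebras -/

section Forms

variable {F : Type u} [Field F]

theorem linear_apply (f : (Fin 5 → F) →ₗ[F] F) (v : Fin 5 → F) :
    f v = v 0 * f (e F 0) + v 1 * f (e F 1) + v 2 * f (e F 2) + v 3 * f (e F 3)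
      + v 4 * f (e F 4) := by
  have h : v = v 0 • e F 0 + v 1 • e F 1 + v 2 • e F 2 + v 3 • e F 3 + v 4 • e F 4 := by
    ext i; fin_cases i <;> simp [e]
  conv_lhs => rw [h]
  simp only [map_add, map_smul, smul_eq_mul]

/-- The linear form with given coefficients. -/
def linForm (g : Fin 5 → F) : (Fin 5 → F) →ₗ[F] F := ∑ k, g k • LinearMap.proj k

theorem linForm_apply (g v : Fin 5 → F) : linForm g v =
    g 0 * v 0 + g 1 * v 1 + g 2 * v 2 + g 3 * v 3 + g 4 * v 4 := by
  simp [linForm, Fin.sum_univ_succ, add_assoc]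

theorem skew_form_apply (hF : ringChar F ≠ 2) (θ : (Fin 5 → F) →ₗ[F] (Fin 5 → F) →ₗ[F] F)
    (h : ∀ x y, θ x y = -θ y x) : ∃ q : Fin 5 → Fin 5 → F, ∀ x y, θ x y =
      q 0 1 * (x 0 * y 1 - x 1 * y 0) + q 0 2 * (x 0 * y 2 - x 2 * y 0)
      + q 0 3 * (x 0 * y 3 - x 3 * y 0) + q 0 4 * (x 0 * y 4 - x 4 * y 0)
      + q 1 2 * (x 1 * y 2 - x 2 * y 1) + q 1 3 * (x 1 * y 3 - x 3 * y 1)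
      + q 1 4 * (x 1 * y 4 - x 4 * y 1) + q 2 3 * (x 2 * y 3 - x 3 * y 2)
      + q 2 4 * (x 2 * y 4 - x 4 * y 2) + q 3 4 * (x 3 * y 4 - x 4 * y 3) := by
  refine ⟨fun i j => θ (e F i) (e F j), fun x y => ?_⟩
  have h0 : ∀ z, θ z z = 0 := fun z => by
    have h2 : (2 : F) * θ z z = 0 := by
      rw [two_mul]; nth_rewrite 1 [h z z]; exact neg_add_cancel _
    exact (mul_eq_zero.mp h2).resolve_left (Ring.two_ne_zero hF)
  have h1 : θ x y = θ.flip y x := rfl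
  rw [h1, linear_apply]
  simp only [LinearMap.flip_apply]
  rw [linear_apply (θ (e F 0)), linear_apply (θ (e F 1)), linear_apply (θ (e F 2)),
    linear_apply (θ (e F 3)), linear_apply (θ (e F 4)), h0, h0, h0, h0, h0,
    h (e F 1) (e F 0), h (e F 2) (e F 0), h (e F 3) (e F 0), h (e F 4) (e F 0),
    h (e F 2) (e F 1), h (e F 3) (e F 1), h (e F 4) (e F 1),
    h (e F 3) (e F 2), h (e F 4) (e F 2), h (e F 4) (e F 3)]
  ring

theorem B2_le_ZM_table (hF : ringChar F ≠ 2) (t : Name) : B2 (table F t) ≤ ZM (table F t) := by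
  rintro _ ⟨f, rfl⟩
  refine ⟨B2_le_ZBL hF (table_isBinaryLie F t) ⟨f, rfl⟩, fun x y z w => ?_⟩
  change f _ = f _ + f _ + f _ + f _
  rw [← map_add, ← map_add, ← map_add]
  congr 1
  simp only [table_apply]
  cases t <;> ext i <;> fin_cases i <;> simp [tableVec] <;> ring

theorem tableH2M_mem_ZM (t : Name) : ∀ θ ∈ tableH2M F t, θ ∈ ZM (table F t) := by
  intro θ hθ
  cases t <;> simp only [tableH2M, List.mem_cons, List.not_mem_nil, or_false] at hθ <;>
    (repeat' (rcases hθ with hθ | hθ)) <;>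
    refine ⟨⟨fun x y => ?_, fun x y => ?_⟩, fun x y z w => ?_⟩ <;>
    simp [delta_apply, table_apply, tableVec] <;> ring

theorem delta_mem_ZBL (t : Name) (ht : t = .L58 ∨ t = .M51) :
    delta F 3 4 ∈ ZBL (table F t) := by
  rcases ht with rfl | rfl <;>
  refine ⟨fun x y => ?_, fun x y => ?_⟩ <;>
    simp [delta_apply, table_apply, tableVec] <;> ring

theorem ZM_apply_eq_zero (hF : ringChar F ≠ 2) (t : Name) (ht : t = .L58 ∨ t = .M51)
    (θ) (h : θ ∈ ZM (table F t)) : θ (e F 3) (e F 4) = 0 := by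
  obtain ⟨q, hq⟩ := skew_form_apply hF θ h.1.1
  rcases ht with rfl | rfl
  -- The left side is `θ([e₁,e₂],[e₁,e₃]) = θ(e₄,e₅)`, while every triple product on the right is
  -- zero.
  · have := h.2 (e F 0) (e F 1) (e F 2) (e F 0)
    simp [hq, table_apply, tableVec, e] at this
    simpa [hq, e] using this
  -- Only `θ([[e₁,e₂],e₄],e₄) = θ(e₅,e₄)` survives in the identity.
  · have := h.2 (e F 1) (e F 3) (e F 3) (e F 0)
    simp [hq, table_apply, tableVec, e] at this
    simpa [hq, e] using this

theorem sum_smul_get_cons {V : Type v} [AddCommGroup V] [Module F V] (a : V) (l : List V)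
    (c : Fin (a :: l).length → F) : ∑ i, c i • (a :: l).get i =
      c ⟨0, Nat.succ_pos _⟩ • a + ∑ i : Fin l.length, c i.succ • l.get i :=
  Fin.sum_univ_succ _

theorem sum_smul_get_nil {V : Type v} [AddCommGroup V] [Module F V]
    (c : Fin ([] : List V).length → F) : ∑ i, c i • ([] : List V).get i = 0 :=
  rfl

theorem forall_get_cons {V : Type v} (a : V) (l : List V) (P : Fin (a :: l).length → Prop) :
    (∀ i, P i) ↔ P ⟨0, Nat.succ_pos _⟩ ∧ ∀ i : Fin l.length, P i.succ :=
  Fin.forall_fin_succ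

theorem coboundary_table_apply (t : Name) (f : (Fin 5 → F) →ₗ[F] F) (x y : Fin 5 → F) :
    coboundary (table F t) f x y = tableVec F t x y 0 * f (e F 0) + tableVec F t x y 1 * f (e F 1)
      + tableVec F t x y 2 * f (e F 2) + tableVec F t x y 3 * f (e F 3)
      + tableVec F t x y 4 * f (e F 4) := by
  rw [← linear_apply, ← table_apply]; rfl

-- Comparing values on the ten pairs of basis vectors gives a triangular linear system. The list is
-- a variable `l` so that `subst` can rewrite the type `Fin l.length` on which `c` depends.
set_option maxHeartbeats 4000000 in
theorem tableH2M_independent_aux (t : Name) (l : List ((Fin 5 → F) →ₗ[F] (Fin 5 → F) →ₗ[F] F))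
    (hl : tableH2M F t = l) (c : Fin l.length → F) (f : (Fin 5 → F) →ₗ[F] F)
    (h : ∑ i, c i • l.get i = coboundary (table F t) f) : ∀ i, c i = 0 := by
  have key : ∀ i j, (∑ i, c i • l.get i) (e F i) (e F j) =
      coboundary (table F t) f (e F i) (e F j) := by
    intro x y; rw [h]
  clear h
  simp only [coboundary_table_apply] at key
  cases t <;> simp only [tableH2M] at hl <;> subst hl <;>
    simp only [sum_smul_get_cons, sum_smul_get_nil, forall_get_cons] at key ⊢
  all_goals
    have k01 := key 0 1
    have k02 := key 0 2
    have k03 := key 0 3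
    have k04 := key 0 4
    have k12 := key 1 2
    have k13 := key 1 3
    have k14 := key 1 4
    have k23 := key 2 3
    have k24 := key 2 4
    have k34 := key 3 4
    clear key
    simp [tableVec, delta_apply, e] at k01 k02 k03 k04 k12 k13 k14 k23 k24 k34
    simp_all

theorem tableH2M_independent (t : Name) (c : Fin (tableH2M F t).length → F)
    (f : (Fin 5 → F) →ₗ[F] F)
    (h : ∑ i, c i • (tableH2M F t).get i = coboundary (table F t) f) : c = 0 :=
  funext (tableH2M_independent_aux t _ rfl c f h)

-- The form `f` is chosen so that its coboundary absorbs one coordinate of `θ` for each basis vector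
-- of `[A,A]`. The remaining unlisted coordinates vanish, or are tied to listed ones, by the binary
-- Lie condition at the vectors shown; for `L51`, `L52`, `L54` and `L58` that condition yields
-- nothing beyond skewness. The vanishing of `θ(e₄,e₅)` is a separate hypothesis because it is all
-- that the Malcev condition adds, so one computation serves both cohomologies.
set_option maxHeartbeats 4000000 in
theorem span_of_ZBL (hF : ringChar F ≠ 2) (t : Name) (θ) (h : θ ∈ ZBL (table F t))
    (h34 : t = .L58 ∨ t = .M51 → θ (e F 3) (e F 4) = 0) :
    ∃ f : (Fin 5 → F) →ₗ[F] F,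
      θ - coboundary (table F t) f ∈ Submodule.span F {x | x ∈ tableH2M F t} := by
  have h2 : (2 : F) ≠ 0 := Ring.two_ne_zero hF
  obtain ⟨q, hq⟩ := skew_form_apply hF θ h.1
  have key := h.2
  clear h
  have q34 : t = .L58 ∨ t = .M51 → q 3 4 = 0 := by
    intro h
    simpa [hq, e] using h34 h
  clear h34
  have mem_sum : ∀ (f : (Fin 5 → F) →ₗ[F] F) (η : (Fin 5 → F) →ₗ[F] (Fin 5 → F) →ₗ[F] F),
      η ∈ Submodule.span F {x | x ∈ tableH2M F t} →
      (∀ x y, θ x y = η x y + coboundary (table F t) f x y) →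
      ∃ f : (Fin 5 → F) →ₗ[F] F,
        θ - coboundary (table F t) f ∈ Submodule.span F {x | x ∈ tableH2M F t} := by
    intro f η hη h
    refine ⟨f, ?_⟩
    rwa [show θ - coboundary (table F t) f = η from
      LinearMap.ext fun x => LinearMap.ext fun y => by simp [h x y]]
  cases t
  case L51 =>
    refine mem_sum (linForm ![0, 0, 0, 0, 0]) (
      q 0 1 • delta F 0 1 + q 0 2 • delta F 0 2 + q 0 3 • delta F 0 3 + q 1 2 • delta F 1 2
      + q 1 3 • delta F 1 3 + q 2 3 • delta F 2 3 + q 0 4 • delta F 0 4 + q 1 4 • delta F 1 4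
      + q 2 4 • delta F 2 4 + q 3 4 • delta F 3 4) ?_ fun x y => ?_
    · repeat' apply add_mem
      all_goals exact Submodule.smul_mem _ _ (Submodule.subset_span (by simp [tableH2M]))
    · simp [coboundary_table_apply, hq, delta_apply, linForm_apply, tableVec, e]
      grind
  case L52 =>
    refine mem_sum (linForm ![0, 0, q 0 1, 0, 0]) (
      q 0 2 • delta F 0 2 + q 0 3 • delta F 0 3 + q 1 2 • delta F 1 2 + q 1 3 • delta F 1 3
      + q 2 3 • delta F 2 3 + q 0 4 • delta F 0 4 + q 1 4 • delta F 1 4 + q 2 4 • delta F 2 4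
      + q 3 4 • delta F 3 4) ?_ fun x y => ?_
    · repeat' apply add_mem
      all_goals exact Submodule.smul_mem _ _ (Submodule.subset_span (by simp [tableH2M]))
    · simp [coboundary_table_apply, hq, delta_apply, linForm_apply, tableVec, e]
      grind
  case L53 =>
    have k0 := key ![1, 0, 0, 0, 0] ![0, 1, 0, 0, 0]
    have k1 := key ![1, 0, 0, 0, 0] ![0, 1, 1, 0, 0]
    have k2 := key ![1, 0, 0, 0, 0] ![0, 1, 0, 0, 1]
    simp [hq, table_apply, tableVec] at k0 k1 k2
    refine mem_sum (linForm ![0, 0, q 0 1, q 0 2, 0]) (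
      q 0 3 • delta F 0 3 + q 1 2 • delta F 1 2 + q 0 4 • delta F 0 4 + q 1 4 • delta F 1 4
      + q 2 4 • delta F 2 4) ?_ fun x y => ?_
    · repeat' apply add_mem
      all_goals exact Submodule.smul_mem _ _ (Submodule.subset_span (by simp [tableH2M]))
    · simp [coboundary_table_apply, hq, delta_apply, linForm_apply, tableVec, e]
      grind
  case L54 =>
    -- Two products equal `e₅`, so the coboundary that removes `Δ₁₂` also contributes to `Δ₃₄`;
    -- hence the corrected coefficient `q 2 3 - q 0 1`.
    refine mem_sum (linForm ![0, 0, 0, 0, q 0 1]) (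
      q 0 2 • delta F 0 2 + q 0 3 • delta F 0 3 + q 1 2 • delta F 1 2 + q 1 3 • delta F 1 3
      + (q 2 3 - q 0 1) • delta F 2 3 + q 0 4 • delta F 0 4 + q 1 4 • delta F 1 4
      + q 2 4 • delta F 2 4 + q 3 4 • delta F 3 4) ?_ fun x y => ?_
    · repeat' apply add_mem
      all_goals exact Submodule.smul_mem _ _ (Submodule.subset_span (by simp [tableH2M]))
    · simp [coboundary_table_apply, hq, delta_apply, linForm_apply, tableVec, e]
      grind
  case L55 =>
    have k0 := key ![1, 0, 0, 0, 0] ![0, 1, 0, 0, 0]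
    have k1 := key ![1, 0, 0, 0, 0] ![0, 1, 1, 0, 0]
    have k2 := key ![1, 0, 0, 0, 0] ![0, 1, 0, 1, 0]
    simp [hq, table_apply, tableVec] at k0 k1 k2
    refine mem_sum (linForm ![0, 0, q 0 1, 0, q 1 3]) (
      (q 0 2 - q 1 3) • delta F 0 2 + q 0 3 • delta F 0 3 + q 1 2 • delta F 1 2
      + q 2 3 • delta F 2 3 + q 0 4 • delta F 0 4) ?_ fun x y => ?_
    · repeat' apply add_mem
      all_goals exact Submodule.smul_mem _ _ (Submodule.subset_span (by simp [tableH2M]))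
    · simp [coboundary_table_apply, hq, delta_apply, linForm_apply, tableVec, e]
      grind
  case L56 =>
    have k0 := key ![1, 0, 0, 0, 0] ![0, 1, 0, 0, 0]
    have k1 := key ![1, 0, 0, 0, 0] ![0, 1, 1, 0, 0]
    have k2 := key ![1, 0, 0, 0, 0] ![0, 1, -1, 0, 0]
    have k3 := key ![1, 0, 0, 0, 0] ![0, 1, 0, 0, 1]
    simp [hq, table_apply, tableVec] at k0 k1 k2 k3
    refine mem_sum (linForm ![0, 0, q 0 1, q 0 2, q 1 2]) (
      (q 0 3 - q 1 2) • delta F 0 3 + q 0 4 • (delta F 0 4 + delta F 1 3)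
      + q 1 4 • (delta F 1 4 - delta F 2 3)) ?_ fun x y => ?_
    · repeat' apply add_mem
      all_goals exact Submodule.smul_mem _ _ (Submodule.subset_span (by simp [tableH2M]))
    · simp [coboundary_table_apply, hq, delta_apply, linForm_apply, tableVec, e]
      grind
  case L57 =>
    have k0 := key ![1, 0, 0, 0, 0] ![0, 1, 0, 0, 0]
    have k1 := key ![1, 0, 0, 0, 0] ![0, 1, 1, 0, 0]
    have k2 := key ![1, 0, 0, 0, 0] ![0, 1, -1, 0, 0]
    have k3 := key ![1, 0, 0, 0, 0] ![0, 1, 0, 0, 1]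
    simp [hq, table_apply, tableVec] at k0 k1 k2 k3
    refine mem_sum (linForm ![0, 0, q 0 1, q 0 2, q 0 3]) (
      q 0 4 • delta F 0 4 + q 1 2 • delta F 1 2 + q 1 4 • (delta F 1 4 - delta F 2 3)) ?_ fun x y => ?_
    · repeat' apply add_mem
      all_goals exact Submodule.smul_mem _ _ (Submodule.subset_span (by simp [tableH2M]))
    · simp [coboundary_table_apply, hq, delta_apply, linForm_apply, tableVec, e]
      grind
  case L58 =>
    have q34 := q34 (by simp)
    refine mem_sum (linForm ![0, 0, 0, q 0 1, q 0 2]) (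
      q 0 3 • delta F 0 3 + q 0 4 • delta F 0 4 + q 1 2 • delta F 1 2 + q 1 3 • delta F 1 3
      + q 2 3 • delta F 2 3 + q 1 4 • delta F 1 4 + q 2 4 • delta F 2 4) ?_ fun x y => ?_
    · repeat' apply add_mem
      all_goals exact Submodule.smul_mem _ _ (Submodule.subset_span (by simp [tableH2M]))
    · simp [coboundary_table_apply, hq, delta_apply, linForm_apply, tableVec, e]
      grind
  case L59 =>
    have k0 := key ![1, 0, 0, 0, 0] ![0, 1, 0, 0, 0]
    have k1 := key ![1, 0, 0, 0, 0] ![0, 1, 1, 0, 0]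
    have k2 := key ![1, 0, 0, 0, 0] ![0, 1, 0, 0, 1]
    have k3 := key ![1, 0, 1, 0, 0] ![0, 1, 0, 0, 0]
    simp [hq, table_apply, tableVec] at k0 k1 k2 k3
    refine mem_sum (linForm ![0, 0, q 0 1, q 0 2, q 1 2]) (
      q 0 3 • delta F 0 3 + q 0 4 • (delta F 0 4 + delta F 1 3) + q 1 4 • delta F 1 4) ?_ fun x y => ?_
    · repeat' apply add_mem
      all_goals exact Submodule.smul_mem _ _ (Submodule.subset_span (by simp [tableH2M]))
    · simp [coboundary_table_apply, hq, delta_apply, linForm_apply, tableVec, e]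
      grind
  case M51 =>
    have k0 := key ![1, 0, 0, 1, 0] ![0, 1, 0, 0, 0]
    have k1 := key ![1, 0, 0, 0, 0] ![0, 1, 0, 1, 0]
    have k2 := key ![1, 0, 0, 1, 0] ![0, 1, 1, 0, 0]
    simp [hq, table_apply, tableVec] at k0 k1 k2
    have q34 := q34 (by simp)
    refine mem_sum (linForm ![0, 0, q 0 1, 0, q 2 3]) (
      q 0 2 • delta F 0 2 + q 0 3 • delta F 0 3 + q 1 2 • delta F 1 2 + q 1 3 • delta F 1 3) ?_ fun x y => ?_
    · repeat' apply add_mem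
      all_goals exact Submodule.smul_mem _ _ (Submodule.subset_span (by simp [tableH2M]))
    · simp [coboundary_table_apply, hq, delta_apply, linForm_apply, tableVec, e]
      grind

end Forms

/-! ### Cohomology spaces, annihilators and the sets `U` -/

section Conclusions

variable {F : Type u} [Field F]

theorem isClassBasis_table (hF : ringChar F ≠ 2) (t : Name) :
    IsClassBasis (table F t) (tableH2M F t) (H2M (table F t)) :=
  isClassBasis_of (fun _ => tableH2M_mem_ZM t _ (List.get_mem _ _)) (tableH2M_independent t)
    fun θ hθ => span_of_ZBL hF t θ hθ.1 fun ht => ZM_apply_eq_zero hF t ht θ hθ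

theorem mem_ZM_of_ZBL (hF : ringChar F ≠ 2) (t : Name) (θ) (h : θ ∈ ZBL (table F t))
    (h34 : t = .L58 ∨ t = .M51 → θ (e F 3) (e F 4) = 0) : θ ∈ ZM (table F t) := by
  obtain ⟨f, hf⟩ := span_of_ZBL hF t θ h h34
  have h1 := Submodule.span_le.2 (show {x | x ∈ tableH2M F t} ⊆ (ZM (table F t) : Set _) from
    tableH2M_mem_ZM t) hf
  have h2 : coboundary (table F t) f ∈ ZM (table F t) := B2_le_ZM_table hF t ⟨f, rfl⟩
  simpa using add_mem h1 h2

theorem H2M_table_eq_top (hF : ringChar F ≠ 2) (t : Name) (h58 : t ≠ .L58) (h51 : t ≠ .M51) :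
    H2M (table F t) = ⊤ :=
  H2M_eq_top fun θ hθ => mem_ZM_of_ZBL hF t θ hθ fun h => (h.elim h58 h51).elim

theorem delta_notMem_ZM (hF : ringChar F ≠ 2) (t : Name) (ht : t = .L58 ∨ t = .M51) :
    delta F 3 4 ∉ ZM (table F t) := by
  intro h
  have := ZM_apply_eq_zero hF t ht _ h
  simp [delta_apply, e] at this

theorem isCompl_H2M (hF : ringChar F ≠ 2) (t : Name) (ht : t = .L58 ∨ t = .M51) :
    ∃ z : ZBL (table F t), (z : (Fin 5 → F) →ₗ[F] (Fin 5 → F) →ₗ[F] F) = delta F 3 4 ∧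
      cls (table F t) z ≠ 0 ∧
      IsCompl (H2M (table F t)) (Submodule.span F {cls (table F t) z}) := by
  have hz : cls (table F t) ⟨delta F 3 4, delta_mem_ZBL t ht⟩ ∉ H2M (table F t) := by
    rw [cls_mem_H2M (B2_le_ZM_table hF t)]
    exact delta_notMem_ZM hF t ht
  refine ⟨⟨delta F 3 4, delta_mem_ZBL t ht⟩, rfl, fun h => hz (h ▸ zero_mem _), ?_, ?_⟩
  · rw [Submodule.disjoint_def]
    intro x hx hx2
    obtain ⟨c, rfl⟩ := Submodule.mem_span_singleton.1 hx2
    by_cases hc : c = 0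
    · rw [hc, zero_smul]
    · exact absurd (((H2M (table F t)).smul_mem_iff hc).1 hx) hz
  · rw [codisjoint_iff, eq_top_iff]
    intro x _
    obtain ⟨θ, rfl⟩ := cls_surjective _ x
    set D : ZBL (table F t) := ⟨delta F 3 4, delta_mem_ZBL t ht⟩ with hD
    -- Since `Δ₄₅(e₄,e₅) = 1`, subtracting this multiple leaves a cocycle vanishing at `(e₄,e₅)`,
    -- hence a Malcev one.
    have h1 : θ = (θ - θ.1 (e F 3) (e F 4) • D) + θ.1 (e F 3) (e F 4) • D := by abel
    rw [h1, map_add, map_smul]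
    refine Submodule.add_mem_sup ?_ (Submodule.smul_mem _ _ (Submodule.mem_span_singleton_self _))
    rw [cls_mem_H2M (B2_le_ZM_table hF t)]
    refine mem_ZM_of_ZBL hF t _ (Subtype.mem _) fun _ => ?_
    change θ.1 (e F 3) (e F 4) - θ.1 (e F 3) (e F 4) * delta F 3 4 (e F 3) (e F 4) = 0
    simp [delta_apply, e]

theorem mem_Ann_table (t : Name) (x : Fin 5 → F) :
    x ∈ Ann (table F t) ↔ ∀ j, tableVec F t x (e F j) = 0 := by
  rw [Ann, LinearMap.mem_ker]
  constructor
  · intro h j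
    rw [← table_apply, h]; rfl
  · intro h
    refine LinearMap.pi_ext' fun j => LinearMap.ext_ring ?_
    change table F t x (Pi.single j 1) = 0
    rw [table_apply]
    exact h j

theorem mem_span_e_iff (s : Set (Fin 5)) (x : Fin 5 → F) :
    x ∈ Submodule.span F (e F '' s) ↔ ∀ i, i ∉ s → x i = 0 := by
  have h := (Pi.basisFun F (Fin 5)).mem_span_image (m := x) (s := s)
  have h2 : (⇑(Pi.basisFun F (Fin 5))) = e F := by
    ext i : 1; exact Pi.basisFun_apply F _ i
  rw [h2] at h
  rw [h]
  constructor
  · intro hs i hi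
    by_contra hne
    exact hi (hs (by simpa using hne))
  · intro hs i hi
    by_contra hne
    simp at hi
    exact hi (hs i hne)

theorem Ann_table (t : Name) : Ann (table F t) = tableAnn F t := by
  ext x
  rw [mem_Ann_table]
  have h1 : ∀ a, Submodule.span F {e F a} = Submodule.span F (e F '' {a}) := by simp
  have h2 : ∀ a b, Submodule.span F {e F a, e F b} = Submodule.span F (e F '' {a, b}) := by
    simp [Set.image_insert_eq]
  have h3 : ∀ a b c, Submodule.span F {e F a, e F b, e F c} =
      Submodule.span F (e F '' {a, b, c}) := by simp [Set.image_insert_eq]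
  cases t <;> simp only [tableAnn, h1, h2, h3, mem_span_e_iff] <;>
    simp [tableVec, e, Fin.forall_fin_succ, funext_iff] <;> grind

theorem U_nonempty_iff (hF : ringChar F ≠ 2) (t : Name) :
    (U (table F t) 1).Nonempty ↔ t = .L58 ∨ t = .M51 := by
  constructor
  · rintro ⟨W, _, hW⟩
    by_contra ht
    rw [not_or] at ht
    exact hW (H2M_table_eq_top hF t ht.1 ht.2 ▸ le_top)
  · intro ht
    obtain ⟨z, hz, h0, hc⟩ := isCompl_H2M hF t ht
    refine ⟨Submodule.span F {cls (table F t) z},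
      ⟨finrank_span_singleton h0, fun _ => z, by rw [Set.range_const], ?_⟩, fun h => h0 ?_⟩
    -- Orthogonality to `Δ₄₅` kills the last two coordinates, and in both algebras the annihilator
    -- lies in `⟨e₄,e₅⟩`.
    · rw [iInf_const, hz, eq_bot_iff, Ann_table]
      rintro x ⟨hx1, hx2⟩
      have h3 : x 3 = 0 := by
        have := LinearMap.congr_fun (LinearMap.mem_ker.1 hx1) (e F 4)
        simpa [delta_apply, e] using this
      have h4 : x 4 = 0 := by
        have := LinearMap.congr_fun (LinearMap.mem_ker.1 hx1) (e F 3)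
        simpa [delta_apply, e] using this
      rw [SetLike.mem_coe, ← Ann_table, mem_Ann_table] at hx2
      rw [Submodule.mem_bot]
      rcases ht with rfl | rfl <;>
        simp [tableVec, e, Fin.forall_fin_succ, funext_iff] at hx2 ⊢ <;> grind
    · exact Submodule.disjoint_def.1 hc.1 _ (h (Submodule.mem_span_singleton_self _))
        (Submodule.mem_span_singleton_self _)

end Conclusions

/-! ### Invariants and pairwise nonisomorphism -/

section Isomorphisms

variable {F : Type u} [Field F] {A : Type v} [AddCommGroup A] [Module F A]
  {B : Type w} [AddCommGroup B] [Module F B]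
  {μ : A →ₗ[F] A →ₗ[F] A} {ν : B →ₗ[F] B →ₗ[F] B}

theorem Isomorphic.symm (h : Isomorphic μ ν) : Isomorphic ν μ := by
  obtain ⟨f, hf⟩ := h
  exact ⟨f.symm, fun x y => f.injective (by simp [hf])⟩

theorem Isomorphic.trans {C : Type*} [AddCommGroup C] [Module F C] {ξ : C →ₗ[F] C →ₗ[F] C}
    (h : Isomorphic μ ν) (h' : Isomorphic ν ξ) : Isomorphic μ ξ := by
  obtain ⟨f, hf⟩ := h
  obtain ⟨g, hg⟩ := h'
  exact ⟨f.trans g, fun x y => by simp [hf, hg]⟩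

theorem Isomorphic.isMalcev (h : Isomorphic μ ν) (hν : IsMalcev ν) : IsMalcev μ := by
  obtain ⟨f, hf⟩ := h
  refine ⟨fun x y => f.injective ?_, fun x y z => f.injective ?_⟩
  · rw [map_neg, hf, hf, hν.1]
  · simpa [jacobian, hf] using hν.2 (f x) (f y) (f z)

theorem Isomorphic.isLie (h : Isomorphic μ ν) (hν : IsLie ν) : IsLie μ := by
  obtain ⟨f, hf⟩ := h
  refine ⟨fun x y => f.injective ?_, fun x y z => f.injective ?_⟩
  · rw [map_neg, hf, hf, hν.1]
  · simpa [jacobian, hf] using hν.2 (f x) (f y) (f z)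

theorem Isomorphic.finrank_Ann (h : Isomorphic μ ν) :
    Module.finrank F (Ann μ) = Module.finrank F (Ann ν) := by
  obtain ⟨f, hf⟩ := h
  have : (Ann μ).map (f : A →ₗ[F] B) = Ann ν := by
    ext x
    simp only [Submodule.mem_map, Ann, LinearMap.mem_ker]
    constructor
    · rintro ⟨a, ha, rfl⟩
      ext y
      obtain ⟨y, rfl⟩ := f.surjective y
      change ν (f a) (f y) = 0
      rw [← hf, ha]; simp
    · intro hx
      obtain ⟨x, rfl⟩ := f.surjective x
      refine ⟨x, LinearMap.ext fun y => f.injective ?_, rfl⟩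
      rw [hf, hx]; simp
  rw [← this]
  exact (LinearEquiv.finrank_map_eq f _).symm

/-- The annihilator of `[A,A]`. -/
def derivedAnn (μ : A →ₗ[F] A →ₗ[F] A) : Submodule F A where
  carrier := {x | ∀ y z, μ x (μ y z) = 0}
  zero_mem' := by simp
  add_mem' := by
    intro x x' h h' y z
    rw [map_add, LinearMap.add_apply, h, h', add_zero]
  smul_mem' := by
    intro c x h y z
    rw [map_smul, LinearMap.smul_apply, h, smul_zero]

theorem Isomorphic.finrank_derivedAnn (h : Isomorphic μ ν) :
    Module.finrank F (derivedAnn μ) = Module.finrank F (derivedAnn ν) := by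
  obtain ⟨f, hf⟩ := h
  have : (derivedAnn μ).map (f : A →ₗ[F] B) = derivedAnn ν := by
    ext x
    rw [Submodule.mem_map]
    constructor
    · rintro ⟨a, ha, rfl⟩ y z
      obtain ⟨y, rfl⟩ := f.surjective y
      obtain ⟨z, rfl⟩ := f.surjective z
      change ν (f a) _ = 0
      rw [← hf, ← hf, ha, map_zero]
    · intro hx
      obtain ⟨x, rfl⟩ := f.surjective x
      refine ⟨x, fun y z => f.injective ?_, rfl⟩
      rw [hf, hf, hx, map_zero]
  rw [← this]
  exact (LinearEquiv.finrank_map_eq f _).symm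

theorem Isomorphic.triple_eq_zero (h : Isomorphic μ ν)
    (hν : ∀ x y z w, ν x (ν y (ν z w)) = 0) (x y z w : A) : μ x (μ y (μ z w)) = 0 := by
  obtain ⟨f, hf⟩ := h
  apply f.injective
  rw [hf, hf, hf, hν, map_zero]

variable (F) in
theorem finrank_span_e (s : Finset (Fin 5)) :
    Module.finrank F (Submodule.span F (e F '' (s : Set (Fin 5)))) = s.card := by
  have h2 : (⇑(Pi.basisFun F (Fin 5))) = e F := by
    ext i : 1; exact Pi.basisFun_apply F _ i
  have h : LinearIndependent F (fun i : s => e F i) := by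
    rw [← h2]
    exact (Pi.basisFun F (Fin 5)).linearIndependent.comp _ Subtype.val_injective
  have h3 := finrank_span_eq_card h
  rw [Fintype.card_coe] at h3
  rw [← h3, Set.image_eq_range]
  rfl

/-- The indices of the basis vectors that span the annihilator. -/
def annIndices : Name → Finset (Fin 5)
  | .L51 => Finset.univ
  | .L52 => {2, 3, 4}
  | .L53 | .L58 | .L59 => {3, 4}
  | .L54 | .L55 | .L56 | .L57 | .M51 => {4}

/-- The indices of the basis vectors that span the annihilator of `[A,A]`. -/
def derivedAnnIndices : Name → Finset (Fin 5)
  | .L51 | .L52 | .L54 | .L58 => Finset.univ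
  | .L53 | .L55 | .L57 => {1, 2, 3, 4}
  | .M51 => {0, 1, 2, 4}
  | .L56 | .L59 => {2, 3, 4}

/-- With a `Finset` of indices the dimension becomes a cardinality, which `decide` can compare. -/
theorem Ann_table_eq (t : Name) :
    Ann (table F t) = Submodule.span F (e F '' (annIndices t : Set (Fin 5))) := by
  ext x
  rw [mem_Ann_table, mem_span_e_iff]
  cases t <;> simp [annIndices, tableVec, e, Fin.forall_fin_succ, funext_iff] <;> grind

theorem derivedAnn_table_eq (t : Name) :
    derivedAnn (table F t) = Submodule.span F (e F '' (derivedAnnIndices t : Set (Fin 5))) := by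
  ext x
  rw [mem_span_e_iff]
  constructor
  · intro h
    -- Annihilating `[e₁,e₂]` and `[e₁,e₃]` already forces the required coordinates to vanish.
    have h1 := h (e F 0) (e F 1)
    have h2 := h (e F 0) (e F 2)
    cases t <;> simp [table_apply, derivedAnnIndices, tableVec, e, Fin.forall_fin_succ] at h1 h2 ⊢
      <;> grind
  · intro h y z
    rw [table_apply, table_apply]
    cases t <;> simp [derivedAnnIndices, Fin.forall_fin_succ] at h <;> ext i <;> fin_cases i <;>
      simp [tableVec, h]

theorem Isomorphic.card_indices_eq {s t : Name} (h : Isomorphic (table F s) (table F t)) :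
    (annIndices s).card = (annIndices t).card ∧
      (derivedAnnIndices s).card = (derivedAnnIndices t).card := by
  have h1 := h.finrank_Ann
  have h2 := h.finrank_derivedAnn
  rw [Ann_table_eq, Ann_table_eq, finrank_span_e, finrank_span_e] at h1
  rw [derivedAnn_table_eq, derivedAnn_table_eq, finrank_span_e, finrank_span_e] at h2
  exact ⟨h1, h2⟩

theorem Isomorphic.eq_M51_iff {s t : Name} (h : Isomorphic (table F s) (table F t)) :
    s = .M51 ↔ t = .M51 := by
  constructor
  · rintro rfl
    by_contra ht
    exact table_M51_not_isLie F (h.isLie (table_isLie F t ht))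
  · rintro rfl
    by_contra hs
    exact table_M51_not_isLie F (h.symm.isLie (table_isLie F s hs))

/-- These two Lie algebras agree in both dimensions, but `[e₁,[e₁,[e₁,e₂]]] = e₅` in `L57`, while
such products vanish in `L55`. -/
theorem not_isomorphic_L57_L55 : ¬ Isomorphic (table F .L57) (table F .L55) := by
  intro h
  have h1 := h.triple_eq_zero (fun x y z w => by
    simp only [table_apply]
    ext i; fin_cases i <;> simp [tableVec]) (e F 0) (e F 0) (e F 0) (e F 1)
  simpa [table_apply, tableVec, e] using congrFun h1 4

theorem eq_of_isomorphic {s t : Name} (h : Isomorphic (table F s) (table F t)) : s = t := by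
  obtain ⟨h1, h2⟩ := h.card_indices_eq
  have h3 := h.eq_M51_iff
  cases s <;> cases t <;> first
    | rfl
    | exact absurd h1 (by decide)
    | exact absurd h2 (by decide)
    | exact absurd (h3.1 rfl) (by simp)
    | exact absurd (h3.2 rfl) (by simp)
    | exact absurd h not_isomorphic_L57_L55
    | exact absurd h.symm not_isomorphic_L57_L55

end Isomorphisms

/-! ### Recognising an algebra from its multiplication table -/

section Products

variable {F : Type u} [Field F] {A : Type v} [AddCommGroup A] [Module F A]
  {μ : A →ₗ[F] A →ₗ[F] A}

theorem IsAnticommutative.self_eq_zero (hF : ringChar F ≠ 2) (hs : IsAnticommutative μ) (x : A) :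
    μ x x = 0 := by
  have h2 : (2 : F) • μ x x = 0 := by
    rw [two_smul]
    nth_rewrite 1 [hs x x]
    exact neg_add_cancel _
  exact (smul_eq_zero.mp h2).resolve_left (Ring.two_ne_zero hF)

theorem IsAnticommutative.smul_swap (hs : IsAnticommutative μ) {x y z : A} {p : F}
    (h : μ x y = p • z) : μ y x = (-p) • z := by
  rw [hs, h, neg_smul]

theorem top_le_span_of_forall_exists {a b c d f : A}
    (gen : ∀ x, ∃ r s t u v : F, x = r • a + s • b + t • c + u • d + v • f) :
    ⊤ ≤ Submodule.span F (Set.range ![a, b, c, d, f]) := by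
  intro x _
  obtain ⟨r, s, t, u, v, rfl⟩ := gen x
  rw [Submodule.mem_span_range_iff_exists_fun]
  exact ⟨![r, s, t, u, v], by simp [Fin.sum_univ_succ, add_assoc]⟩

variable (F) in
/-- The product of the basis vectors with indices `i` and `j` in an algebra of the table, for the
basis `a`, `b`, `c`, `d`, `f`. -/
def tableCombo (t : Name) (a b c d f : A) (i j : Fin 5) : A :=
  (tableVec F t (e F i) (e F j) 0) • a + (tableVec F t (e F i) (e F j) 1) • b +
    (tableVec F t (e F i) (e F j) 2) • c + (tableVec F t (e F i) (e F j) 3) • d +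
    (tableVec F t (e F i) (e F j) 4) • f

/-- An algebra spanned by five vectors that multiply as the basis vectors of an algebra of the
table is isomorphic to that algebra. -/
theorem isomorphic_of_products (hF : ringChar F ≠ 2) (hs : IsAnticommutative μ)
    (h5 : Module.finrank F A = 5) (t : Name) (a b c d f : A)
    (gen : ∀ x, ∃ r s t u v : F, x = r • a + s • b + t • c + u • d + v • f)
    (h01 : μ a b = tableCombo F t a b c d f 0 1)
    (h02 : μ a c = tableCombo F t a b c d f 0 2)
    (h03 : μ a d = tableCombo F t a b c d f 0 3)
    (h04 : μ a f = tableCombo F t a b c d f 0 4)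
    (h12 : μ b c = tableCombo F t a b c d f 1 2)
    (h13 : μ b d = tableCombo F t a b c d f 1 3)
    (h14 : μ b f = tableCombo F t a b c d f 1 4)
    (h23 : μ c d = tableCombo F t a b c d f 2 3)
    (h24 : μ c f = tableCombo F t a b c d f 2 4)
    (h34 : μ d f = tableCombo F t a b c d f 3 4) :
    Isomorphic μ (table F t) := by
  set m := tableCombo F t a b c d f
  have hm : ∀ i j, m i j = (tableVec F t (e F i) (e F j) 0) • a +
      (tableVec F t (e F i) (e F j) 1) • b + (tableVec F t (e F i) (e F j) 2) • c +
      (tableVec F t (e F i) (e F j) 3) • d + (tableVec F t (e F i) (e F j) 4) • f :=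
    fun _ _ => rfl
  -- Five spanning vectors in dimension five are independent, so no independence has to be checked
  -- in the applications.
  let B : Module.Basis (Fin 5) F A := basisOfTopLeSpanOfCardEqFinrank ![a, b, c, d, f]
    (top_le_span_of_forall_exists gen) (by simp [h5])
  have hB : ∀ i, B i = ![a, b, c, d, f] i := fun i => by
    rw [coe_basisOfTopLeSpanOfCardEqFinrank]
  have hlt : ∀ i j, i < j → μ (B i) (B j) = m i j := by
    intro i j hij
    rw [hB, hB]
    fin_cases i <;> fin_cases j <;> first | exact absurd hij (by decide) | assumption
  have hms : ∀ i j, m i j = - m j i := by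
    intro i j
    have h : tableVec F t (e F i) (e F j) = - tableVec F t (e F j) (e F i) := by
      rw [← table_apply, ← table_apply]; exact table_anticomm F t _ _
    rw [hm, hm, h]
    simp only [Pi.neg_apply]
    module
  have hall : ∀ i j, μ (B i) (B j) = m i j := by
    intro i j
    rcases lt_trichotomy i j with h | rfl | h
    · exact hlt i j h
    · rw [hs.self_eq_zero hF, hm, ← table_apply, (table_anticomm F t).self_eq_zero hF]
      simp
    · rw [hs, hlt j i h, hms]; simp
  refine ⟨B.equivFun, fun x y => ?_⟩
  have hcoord : ∀ i, B.equivFun (B i) = e F i := fun i => by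
    ext j; simp [e, Pi.single_apply, eq_comm]
  have key : μ.compr₂ B.equivFun.toLinearMap =
      (table F t).compl₁₂ B.equivFun.toLinearMap B.equivFun.toLinearMap := by
    refine B.ext fun i => B.ext fun j => ?_
    change B.equivFun (μ (B i) (B j)) = table F t (B.equivFun (B i)) (B.equivFun (B j))
    rw [hcoord, hcoord, hall, hm, table_apply]
    have ha : a = B 0 := (hB 0).symm
    have hb : b = B 1 := (hB 1).symm
    have hc : c = B 2 := (hB 2).symm
    have hd : d = B 3 := (hB 3).symm
    have hf : f = B 4 := (hB 4).symm
    rw [ha, hb, hc, hd, hf]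
    simp only [map_add, map_smul, hcoord]
    ext k; fin_cases k <;> simp [e]
  exact LinearMap.congr_fun₂ key x y

end Products

/-! ### Central elements and central quotients -/

section Nilpotency

variable {F : Type u} [Field F] {A : Type v} [AddCommGroup A] [Module F A]
  {μ : A →ₗ[F] A →ₗ[F] A}

/-- All left-normed products of `n + 1` elements vanish. -/
def LeftNil (μ : A →ₗ[F] A →ₗ[F] A) (n : ℕ) : Prop :=
  ∀ (x : A) (l : List A), l.length = n → l.foldl (fun a b => μ a b) x = 0

theorem power_mul_mem {k : ℕ} {x : A} (hx : x ∈ power μ (k + 1)) (y : A) :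
    μ x y ∈ power μ (k + 2) := by
  rw [power]
  have h1 : y ∈ power μ 1 := by rw [power]; trivial
  exact Submodule.mem_iSup_of_mem (0 : Fin (k + 1)) (Submodule.apply_mem_map₂ μ hx h1)

theorem foldl_mem_power (l : List A) : ∀ (k : ℕ) (x : A), x ∈ power μ (k + 1) →
    l.foldl (fun a b => μ a b) x ∈ power μ (k + l.length + 1) := by
  induction l with
  | nil => intro k x hx; exact hx
  | cons y l ih =>
    intro k x hx
    have := ih (k + 1) _ (power_mul_mem hx y)
    rw [List.foldl_cons, List.length_cons]
    convert this using 2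
    omega

theorem IsNilpotentAlg.exists_leftNil (h : IsNilpotentAlg μ) : ∃ n, LeftNil μ n := by
  obtain ⟨n, hn, h⟩ := h
  obtain ⟨n, rfl⟩ := Nat.exists_eq_add_of_le' hn
  refine ⟨n, fun x l hl => ?_⟩
  have := foldl_mem_power (μ := μ) l 0 x (by rw [power]; trivial)
  rwa [zero_add, hl, h, Submodule.mem_bot] at this

/-- A nonzero left-normed product of maximal length is annihilated by every further factor. -/
theorem LeftNil.exists_central [Nontrivial A] {n : ℕ} (h : LeftNil μ n) :
    ∃ z, z ≠ 0 ∧ ∀ x, μ z x = 0 := by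
  induction n with
  | zero =>
    obtain ⟨x, hx⟩ := exists_ne (0 : A)
    exact absurd (h x [] rfl) hx
  | succ n ih =>
    by_cases hn : LeftNil μ n
    · exact ih hn
    · simp only [LeftNil, not_forall] at hn
      obtain ⟨x, l, hl, hne⟩ := hn
      refine ⟨_, hne, fun y => ?_⟩
      have := h x (l ++ [y]) (by simp [hl])
      simpa using this

/-- Centrality lets the product descend in each argument separately; `flip` exposes the second
argument to `liftQ` before the first. -/
theorem exists_quotient_mul {z : A} (hs : IsAnticommutative μ) (hz : ∀ x, μ z x = 0) :
    ∃ ν : (A ⧸ Submodule.span F {z}) →ₗ[F] (A ⧸ Submodule.span F {z}) →ₗ[F]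
      (A ⧸ Submodule.span F {z}), ∀ x y : A,
      ν (Submodule.Quotient.mk x) (Submodule.Quotient.mk y) = Submodule.Quotient.mk (μ x y) := by
  let p := Submodule.span F {z}
  let f : A →ₗ[F] A →ₗ[F] A ⧸ p := μ.compr₂ p.mkQ
  have hz' : ∀ x, μ x z = 0 := fun x => by rw [hs, hz, neg_zero]
  have h1 : p ≤ LinearMap.ker f.flip := by
    rw [Submodule.span_singleton_le_iff_mem, LinearMap.mem_ker]
    ext x
    change p.mkQ (μ x z) = 0
    rw [hz', map_zero]
  let g : A →ₗ[F] (A ⧸ p) →ₗ[F] A ⧸ p := (p.liftQ f.flip h1).flip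
  have h2 : p ≤ LinearMap.ker g := by
    rw [Submodule.span_singleton_le_iff_mem, LinearMap.mem_ker]
    refine LinearMap.ext fun y => ?_
    obtain ⟨y, rfl⟩ := p.mkQ_surjective y
    change p.mkQ (μ z y) = 0
    rw [hz, map_zero]
  exact ⟨p.liftQ g h2, fun x y => rfl⟩

/-- A central line in a nontrivial nilpotent algebra, with the quotient by it. -/
theorem exists_central_quotient [FiniteDimensional F A] {k n : ℕ}
    (hk : Module.finrank F A = k + 1) (hs : IsAnticommutative μ) (h : LeftNil μ n) :
    ∃ z : A, (∀ x, μ z x = 0) ∧ (∀ x, μ x z = 0) ∧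
      Module.finrank F (A ⧸ Submodule.span F {z}) = k ∧
      ∃ ν : (A ⧸ Submodule.span F {z}) →ₗ[F] (A ⧸ Submodule.span F {z}) →ₗ[F]
        (A ⧸ Submodule.span F {z}), (∀ x y : A,
        ν (Submodule.Quotient.mk x) (Submodule.Quotient.mk y) = Submodule.Quotient.mk (μ x y)) ∧
        IsAnticommutative ν ∧ LeftNil ν n := by
  have : Nontrivial A := Module.nontrivial_of_finrank_pos (R := F) (by omega)
  obtain ⟨z, hz0, hz⟩ := h.exists_central
  obtain ⟨ν, hν⟩ := exists_quotient_mul hs hz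
  refine ⟨z, hz, fun x => by rw [hs, hz, neg_zero], ?_, ν, hν, ?_, ?_⟩
  · have := Submodule.finrank_quotient_add_finrank (Submodule.span F {z})
    rw [finrank_span_singleton hz0] at this
    omega
  · intro x y
    obtain ⟨x, rfl⟩ := Submodule.Quotient.mk_surjective _ x
    obtain ⟨y, rfl⟩ := Submodule.Quotient.mk_surjective _ y
    rw [hν, hν, hs, Submodule.Quotient.mk_neg]
  · have hfold : ∀ (l : List A) (x : A),
        (l.map (Submodule.Quotient.mk (p := Submodule.span F {z}))).foldl (fun a b => ν a b)
          (Submodule.Quotient.mk x) = Submodule.Quotient.mk (l.foldl (fun a b => μ a b) x) := by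
      intro l
      induction l with
      | nil => intro x; rfl
      | cons y l ih => intro x; simp only [List.map_cons, List.foldl_cons, hν, ih]
    intro x l hl
    obtain ⟨x, rfl⟩ := Submodule.Quotient.mk_surjective _ x
    obtain ⟨l, rfl⟩ := (Submodule.Quotient.mk_surjective (Submodule.span F {z})).list_map l
    rw [hfold, h x l (by simpa using hl), Submodule.Quotient.mk_zero]

theorem exists_smul_of_mk_eq_zero {z x : A}
    (h : (Submodule.Quotient.mk x : A ⧸ Submodule.span F {z}) = 0) : ∃ p : F, x = p • z := by
  rw [Submodule.Quotient.mk_eq_zero, Submodule.mem_span_singleton] at h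
  obtain ⟨p, hp⟩ := h
  exact ⟨p, hp.symm⟩

theorem exists_smul_of_mk_eq {z x y : A}
    (h : (Submodule.Quotient.mk x : A ⧸ Submodule.span F {z}) = Submodule.Quotient.mk y) :
    ∃ p : F, x = y + p • z := by
  obtain ⟨p, hp⟩ := exists_smul_of_mk_eq_zero (F := F) (z := z) (x := x - y)
    (by rw [Submodule.Quotient.mk_sub, h, sub_self])
  exact ⟨p, by rw [← hp]; abel⟩

end Nilpotency

/-! ### Classification in dimensions two to five -/

section Classification

variable {F : Type u} [Field F] {A : Type v} [AddCommGroup A] [Module F A]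
  {μ : A →ₗ[F] A →ₗ[F] A}

theorem exists_span_two {n : ℕ} (h2 : Module.finrank F A = 2)
    (hs : IsAnticommutative μ) (hn : LeftNil μ n) :
    ∃ a b : A, (∀ x, ∃ r s : F, x = r • a + s • b) ∧ μ a b = 0 := by
  have hfin : FiniteDimensional F A := Module.finite_of_finrank_pos (by omega)
  obtain ⟨z, -, hz', hQ, -⟩ := exists_central_quotient h2 hs hn
  obtain ⟨q, -, hq⟩ := finrank_eq_one_iff'.1 hQ
  obtain ⟨a, rfl⟩ := Submodule.Quotient.mk_surjective _ q
  refine ⟨a, z, fun x => ?_, hz' a⟩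
  obtain ⟨r, hr⟩ := hq (Submodule.Quotient.mk x)
  obtain ⟨s, hs⟩ := exists_smul_of_mk_eq (y := r • a) hr.symm
  exact ⟨r, s, hs⟩

theorem exists_span_three {n : ℕ} (h3 : Module.finrank F A = 3)
    (hs : IsAnticommutative μ) (hn : LeftNil μ n) :
    ∃ a b c : A, (∀ x, ∃ r s t : F, x = r • a + s • b + t • c) ∧
      (μ a b = 0 ∨ μ a b = c) ∧ μ a c = 0 ∧ μ b c = 0 := by
  have hfin : FiniteDimensional F A := Module.finite_of_finrank_pos (by omega)
  obtain ⟨z, hz, hz', hQ, ν, hν, hνs, hνn⟩ := exists_central_quotient h3 hs hn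
  obtain ⟨a, b, gen, hab⟩ := exists_span_two hQ hνs hνn
  obtain ⟨a, rfl⟩ := Submodule.Quotient.mk_surjective _ a
  obtain ⟨b, rfl⟩ := Submodule.Quotient.mk_surjective _ b
  have gen' : ∀ x, ∃ r s t : F, x = r • a + s • b + t • z := by
    intro x
    obtain ⟨r, s, h⟩ := gen (Submodule.Quotient.mk x)
    obtain ⟨t, h⟩ := exists_smul_of_mk_eq (y := r • a + s • b) h
    exact ⟨r, s, t, h⟩
  rw [hν] at hab
  obtain ⟨p, hp⟩ := exists_smul_of_mk_eq_zero hab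
  by_cases h0 : p = 0
  · exact ⟨a, b, z, gen', Or.inl (by rw [hp, h0, zero_smul]), hz' a, hz' b⟩
  · refine ⟨a, b, p • z, fun x => ?_, Or.inr hp, by rw [map_smul, hz', smul_zero],
      by rw [map_smul, hz', smul_zero]⟩
    obtain ⟨r, s, t, rfl⟩ := gen' x
    exact ⟨r, s, t / p, by match_scalars <;> field_simp⟩

/-- The two normal forms of a nilpotent anticommutative algebra of dimension four that is not
abelian, and the abelian one. -/
def IsNormalFour (μ : A →ₗ[F] A →ₗ[F] A) : Prop :=
  ∃ a b c d : A, (∀ x, ∃ r s t u : F, x = r • a + s • b + t • c + u • d) ∧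
    μ a d = 0 ∧ μ b c = 0 ∧ μ b d = 0 ∧ μ c d = 0 ∧
    ((μ a b = 0 ∧ μ a c = 0) ∨ (μ a b = c ∧ μ a c = 0) ∨ (μ a b = c ∧ μ a c = d))

/-- Modulo `z` the product is a nonzero alternating form in three variables, which has rank two; the
fourth basis vector `c - (q / p) • b + (r / p) • a` spans its radical. -/
theorem isNormalFour_of_rank_two {a b c z : A} {p q r : F} (hs : IsAnticommutative μ)
    (h0 : ∀ x, μ x x = 0) (hz : ∀ x, μ z x = 0) (hz' : ∀ x, μ x z = 0)
    (gen : ∀ x, ∃ r s t u : F, x = r • a + s • b + t • c + u • z)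
    (hab : μ a b = p • z) (hac : μ a c = q • z) (hbc : μ b c = r • z) (hp : p ≠ 0) :
    IsNormalFour μ := by
  have hba := hs.smul_swap hab
  refine ⟨a, b, p • z, c - (q / p) • b + (r / p) • a, fun x => ?_, ?_, ?_, ?_, ?_,
    Or.inr (Or.inl ⟨hab, ?_⟩)⟩
  · obtain ⟨k, l, m, n, rfl⟩ := gen x
    exact ⟨k - m * r / p, l + m * q / p, n / p, m, by match_scalars <;> field_simp <;> ring⟩
  all_goals simp only [map_add, map_sub, map_smul, LinearMap.smul_apply, hab, hac, hba, hbc, h0,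
    hz, hz', smul_zero]
  all_goals first | done | (match_scalars <;> field_simp <;> ring)

/-- Replacing `b` by `b - (r / q) • a` keeps `[a,b]` and makes `b` commute with it. -/
theorem isNormalFour_of_heisenberg {a b z : A} {q r : F} (h0 : ∀ x, μ x x = 0)
    (hz' : ∀ x, μ x z = 0)
    (gen : ∀ x, ∃ r s t u : F, x = r • a + s • b + t • μ a b + u • z)
    (hac : μ a (μ a b) = q • z) (hbc : μ b (μ a b) = r • z) (hq : q ≠ 0) :
    IsNormalFour μ := by
  refine ⟨a, b - (r / q) • a, μ a b, q • z, fun x => ?_, ?_, ?_, ?_, ?_,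
    Or.inr (Or.inr ⟨?_, hac⟩)⟩
  · obtain ⟨k, l, m, n, rfl⟩ := gen x
    exact ⟨k + l * r / q, l, m, n / q, by match_scalars <;> field_simp <;> ring⟩
  all_goals simp only [map_sub, map_smul, LinearMap.smul_apply, LinearMap.sub_apply, hac, hbc, h0,
    hz', smul_zero, sub_zero]
  all_goals first | done | (match_scalars <;> field_simp <;> ring)

theorem isNormalFour (hF : ringChar F ≠ 2) {n : ℕ} (h4 : Module.finrank F A = 4)
    (hs : IsAnticommutative μ) (hn : LeftNil μ n) : IsNormalFour μ := by
  have hfin : FiniteDimensional F A := Module.finite_of_finrank_pos (by omega)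
  have h0 := hs.self_eq_zero hF
  obtain ⟨z, hz, hz', hQ, ν, hν, hνs, hνn⟩ := exists_central_quotient h4 hs hn
  obtain ⟨a, b, c, gen, hab, hac, hbc⟩ := exists_span_three hQ hνs hνn
  obtain ⟨a, rfl⟩ := Submodule.Quotient.mk_surjective _ a
  obtain ⟨b, rfl⟩ := Submodule.Quotient.mk_surjective _ b
  have hlift : ∀ c' : A, Submodule.Quotient.mk c' = c →
      (∀ x, ∃ r s t u : F, x = r • a + s • b + t • c' + u • z) ∧
      (∃ q : F, μ a c' = q • z) ∧ ∃ r : F, μ b c' = r • z := by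
    rintro c rfl
    rw [hν] at hac hbc
    refine ⟨fun x => ?_, exists_smul_of_mk_eq_zero hac, exists_smul_of_mk_eq_zero hbc⟩
    obtain ⟨r, s, t, h⟩ := gen (Submodule.Quotient.mk x)
    obtain ⟨u, h⟩ := exists_smul_of_mk_eq (y := r • a + s • b + t • c) h
    exact ⟨r, s, t, u, h⟩
  rw [hν] at hab
  rcases hab with hab | hab
  · obtain ⟨c, rfl⟩ := Submodule.Quotient.mk_surjective _ c
    obtain ⟨gen', ⟨q, hac'⟩, r, hbc'⟩ := hlift c rfl
    obtain ⟨p, hab'⟩ := exists_smul_of_mk_eq_zero hab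
    by_cases hp : p = 0
    · by_cases hq : q = 0
      · by_cases hr : r = 0
        · refine ⟨a, b, c, z, gen', hz' a, ?_, hz' b, hz' c, Or.inl ⟨?_, ?_⟩⟩ <;> simp [*]
        · refine isNormalFour_of_rank_two (a := b) (b := c) (c := a) hs h0 hz hz' (fun x => ?_)
            hbc' (hs.smul_swap hab') (hs.smul_swap hac') hr
          obtain ⟨k, l, m, n, rfl⟩ := gen' x
          exact ⟨l, m, k, n, by module⟩
      · refine isNormalFour_of_rank_two (a := a) (b := c) (c := b) hs h0 hz hz' (fun x => ?_)
          hac' hab' (hs.smul_swap hbc') hq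
        obtain ⟨k, l, m, n, rfl⟩ := gen' x
        exact ⟨k, m, l, n, by module⟩
    · exact isNormalFour_of_rank_two hs h0 hz hz' gen' hab' hac' hbc' hp
  · obtain ⟨gen', ⟨q, hac'⟩, r, hbc'⟩ := hlift _ hab
    by_cases hq : q = 0
    · by_cases hr : r = 0
      · refine ⟨a, b, μ a b, z, gen', hz' a, ?_, hz' b, hz' _, Or.inr (Or.inl ⟨rfl, ?_⟩)⟩ <;>
          simp [*]
      -- Passing from `(a, b)` to `(b, -a)` preserves `[a,b]` and exchanges the roles of `q` and
      -- `r`.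
      · have hc : μ b (-a) = μ a b := by rw [map_neg, hs a b]
        refine isNormalFour_of_heisenberg (a := b) (b := -a) (q := r) (r := -q) h0 hz'
          (fun x => ?_) (by rw [hc, hbc']) (by rw [hc, map_neg, LinearMap.neg_apply, hac', neg_smul])
          hr
        rw [hc]
        obtain ⟨k, l, m, n, rfl⟩ := gen' x
        exact ⟨l, -k, m, n, by module⟩
    · exact isNormalFour_of_heisenberg h0 hz' gen' hac' hbc' hq

/-- Isomorphic to some algebra of the table. -/
def InTable (μ : A →ₗ[F] A →ₗ[F] A) : Prop := ∃ t : Name, Isomorphic μ (table F t)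

/-- The product is an alternating form on a 4-space, and `a`, `b` span a nondegenerate plane. The
vectors `c'`, `d'` span its orthogonal complement, and `s = [c',d']`, the Pfaffian divided by `p₁`,
distinguishes rank two from rank four. -/
theorem inTable_of_abelian {a b c d z : A} {p₁ p₂ p₃ p₄ p₅ p₆ : F} (hF : ringChar F ≠ 2)
    (h5 : Module.finrank F A = 5) (hs : IsAnticommutative μ)
    (hz : ∀ x, μ z x = 0) (hz' : ∀ x, μ x z = 0)
    (gen : ∀ x, ∃ r s t u v : F, x = r • a + s • b + t • c + u • d + v • z)
    (hab : μ a b = p₁ • z) (hac : μ a c = p₂ • z) (had : μ a d = p₃ • z)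
    (hbc : μ b c = p₄ • z) (hbd : μ b d = p₅ • z) (hcd : μ c d = p₆ • z) (hp : p₁ ≠ 0) :
    InTable μ := by
  have h0 := hs.self_eq_zero hF
  have hba := hs.smul_swap hab
  have hca := hs.smul_swap hac
  have hcb := hs.smul_swap hbc
  obtain ⟨c', hc'⟩ : ∃ x, x = c + (p₄ / p₁) • a - (p₂ / p₁) • b := ⟨_, rfl⟩
  obtain ⟨d', hd'⟩ : ∃ x, x = d + (p₅ / p₁) • a - (p₃ / p₁) • b := ⟨_, rfl⟩
  obtain ⟨s, hs'⟩ : ∃ s, s = p₆ - p₅ * p₂ / p₁ + p₃ * p₄ / p₁ := ⟨_, rfl⟩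
  have hac' : μ a c' = 0 := by
    simp only [hc', map_add, map_sub, map_smul, hab, hac, h0]
    match_scalars; field_simp; ring
  have hbc' : μ b c' = 0 := by
    simp only [hc', map_add, map_sub, map_smul, hba, hbc, h0]
    match_scalars; field_simp; ring
  have had' : μ a d' = 0 := by
    simp only [hd', map_add, map_sub, map_smul, hab, had, h0]
    match_scalars; field_simp; ring
  have hbd' : μ b d' = 0 := by
    simp only [hd', map_add, map_sub, map_smul, hba, hbd, h0]
    match_scalars; field_simp; ring
  have hcd' : μ c' d' = s • z := by
    rw [hc', map_sub, map_add, map_smul, map_smul, LinearMap.sub_apply, LinearMap.add_apply,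
      LinearMap.smul_apply, LinearMap.smul_apply, had', hbd', hd', hs']
    simp only [map_add, map_sub, map_smul, hca, hcb, hcd]
    match_scalars; field_simp; ring
  have gen' : ∀ x, ∃ r s t u v : F, x = r • a + s • b + t • c' + u • d' + v • z := by
    intro x
    obtain ⟨k, l, m, n, o, rfl⟩ := gen x
    refine ⟨k - m * p₄ / p₁ - n * p₅ / p₁, l + m * p₂ / p₁ + n * p₃ / p₁, m, n, o, ?_⟩
    rw [hc', hd']
    match_scalars <;> field_simp <;> ring
  by_cases h : s = 0
  · refine ⟨.L52, isomorphic_of_products hF hs h5 _ a b (p₁ • z) c' d' (fun x => ?_)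
      ?_ ?_ ?_ ?_ ?_ ?_ ?_ ?_ ?_ ?_⟩
    · obtain ⟨k, l, m, n, o, rfl⟩ := gen' x
      exact ⟨k, l, o / p₁, m, n, by match_scalars <;> field_simp⟩
    all_goals simp [tableCombo, tableVec, e, hz, hz', hab, hac', hbc', had', hbd', hcd', h]
  · refine ⟨.L54, isomorphic_of_products hF hs h5 _ a b c' ((p₁ / s) • d') (p₁ • z) (fun x => ?_)
      ?_ ?_ ?_ ?_ ?_ ?_ ?_ ?_ ?_ ?_⟩
    · obtain ⟨k, l, m, n, o, rfl⟩ := gen' x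
      exact ⟨k, l, m, n * s / p₁, o / p₁, by match_scalars <;> field_simp⟩
    all_goals simp [tableCombo, tableVec, e, hz', hab, hac', hbc', had', hbd', hcd', smul_smul, h]

/-- As `[[a,b],d] = t • z` with `t ≠ 0`, adding multiples of `c = [a,b]` and `d` to `a` and `b`
clears their products with `c` and `d`. The scalar `u` is the resulting change of `[a,b]` along `z`.
-/
theorem inTable_of_M51 {a b d z : A} {p q r s t : F} (hF : ringChar F ≠ 2)
    (h5 : Module.finrank F A = 5) (hs : IsAnticommutative μ)
    (hz : ∀ x, μ z x = 0) (hz' : ∀ x, μ x z = 0)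
    (gen : ∀ x, ∃ r s t u v : F, x = r • a + s • b + t • μ a b + u • d + v • z)
    (hac : μ a (μ a b) = p • z) (hbc : μ b (μ a b) = q • z) (had : μ a d = r • z)
    (hbd : μ b d = s • z) (hcd : μ (μ a b) d = t • z) (ht : t ≠ 0) : InTable μ := by
  have h0 := hs.self_eq_zero hF
  generalize hab : μ a b = c at gen hac hbc hcd
  have hcb := hs.smul_swap hbc
  have hdb := hs.smul_swap hbd
  have hdc := hs.smul_swap hcd
  obtain ⟨α, hα⟩ : ∃ α, α = -r / t := ⟨_, rfl⟩
  obtain ⟨β, hβ⟩ : ∃ β, β = p / t := ⟨_, rfl⟩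
  obtain ⟨γ, hγ⟩ : ∃ γ, γ = -s / t := ⟨_, rfl⟩
  obtain ⟨δ, hδ⟩ : ∃ δ, δ = q / t := ⟨_, rfl⟩
  obtain ⟨u, hu⟩ : ∃ u, u = γ * p + δ * r - α * q - β * s + (α * δ - β * γ) * t := ⟨_, rfl⟩
  refine ⟨.M51, isomorphic_of_products hF hs h5 _ (a + α • c + β • d) (b + γ • c + δ • d)
    (c + u • z) d (t • z) (fun x => ?_) ?_ ?_ ?_ ?_ ?_ ?_ ?_ ?_ ?_ ?_⟩
  · obtain ⟨k, l, m, n, o, rfl⟩ := gen x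
    refine ⟨k, l, m - k * α - l * γ, n - k * β - l * δ, (o - u * (m - k * α - l * γ)) / t, ?_⟩
    match_scalars <;> field_simp <;> ring
  all_goals
    simp [tableCombo, tableVec, e, hz, hz', hab, hac, hbc, had, hbd, hcd, hcb, hdb, hdc, h0]
  all_goals first | done | (match_scalars <;> simp only [hu, hα, hβ, hγ, hδ] <;> field_simp <;> ring)

theorem inTable_of_L58 {a b d z : A} {r s : F} (hF : ringChar F ≠ 2)
    (h5 : Module.finrank F A = 5) (hs : IsAnticommutative μ)
    (hz' : ∀ x, μ x z = 0)
    (gen : ∀ x, ∃ r s t u v : F, x = r • a + s • b + t • μ a b + u • d + v • z)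
    (hac : μ a (μ a b) = 0) (hbc : μ b (μ a b) = 0) (had : μ a d = r • z)
    (hbd : μ b d = s • z) (hcd : μ (μ a b) d = 0) (hr : r ≠ 0) : InTable μ := by
  have h0 := hs.self_eq_zero hF
  generalize hab : μ a b = c at gen hac hbc hcd
  have hdc : μ d c = 0 := by rw [hs, hcd, neg_zero]
  refine ⟨.L58, isomorphic_of_products hF hs h5 _ a (b - (s / r) • a) d c (r • z)
    (fun x => ?_) ?_ ?_ ?_ ?_ ?_ ?_ ?_ ?_ ?_ ?_⟩
  · obtain ⟨k, l, m, n, o, rfl⟩ := gen x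
    refine ⟨k + l * s / r, l, n, m, o / r, ?_⟩
    match_scalars <;> field_simp <;> ring
  all_goals
    simp [tableCombo, tableVec, e, hz', hab, hac, hbc, had, hbd, hdc, h0, smul_smul, hr]

/-- The nonzero product `[a,c]`, with `c = [a,b]`, is used to clear `[b,c]` by changing `b` and
`[a,d]` by changing `d`. What is left is `[b',d'] = w • z`, and `w` decides between the two
algebras. -/
theorem inTable_of_L53_L55 {a b d z : A} {p q r s : F} (hF : ringChar F ≠ 2)
    (h5 : Module.finrank F A = 5) (hs : IsAnticommutative μ)
    (hz : ∀ x, μ z x = 0) (hz' : ∀ x, μ x z = 0)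
    (gen : ∀ x, ∃ r s t u v : F, x = r • a + s • b + t • μ a b + u • d + v • z)
    (hac : μ a (μ a b) = p • z) (hbc : μ b (μ a b) = q • z) (had : μ a d = r • z)
    (hbd : μ b d = s • z) (hcd : μ (μ a b) d = 0) (hp : p ≠ 0) : InTable μ := by
  have h0 := hs.self_eq_zero hF
  generalize hab : μ a b = c at gen hac hbc hcd
  obtain ⟨b', hb'⟩ : ∃ x, x = b - (q / p) • a := ⟨_, rfl⟩
  obtain ⟨d', hd'⟩ : ∃ x, x = d - (r / p) • c := ⟨_, rfl⟩
  obtain ⟨w, hw⟩ : ∃ w, w = s - q * r / p := ⟨_, rfl⟩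
  have hab' : μ a b' = c := by rw [hb', map_sub, map_smul, h0, hab]; simp
  have hbc' : μ b' c = 0 := by
    simp only [hb', map_sub, map_smul, LinearMap.sub_apply, LinearMap.smul_apply, hbc, hac]
    match_scalars; field_simp; ring
  have had' : μ a d' = 0 := by
    simp only [hd', map_sub, map_smul, had, hac]
    match_scalars; field_simp; ring
  have hbd' : μ b' d' = w • z := by
    rw [hd', map_sub, map_smul, hbc', hb', hw]
    simp only [map_sub, map_smul, LinearMap.sub_apply, LinearMap.smul_apply, hbd, had]
    match_scalars; field_simp
  have hcd' : μ c d' = 0 := by rw [hd', map_sub, map_smul, hcd, h0]; simp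
  have gen' : ∀ x, ∃ r s t u v : F, x = r • a + s • b' + t • c + u • d' + v • z := by
    intro x
    obtain ⟨k, l, m, n, o, rfl⟩ := gen x
    refine ⟨k + l * q / p, l, m + n * r / p, n, o, ?_⟩
    rw [hb', hd']
    match_scalars <;> field_simp <;> ring
  by_cases h : w = 0
  · refine ⟨.L53, isomorphic_of_products hF hs h5 _ a b' c (p • z) d' (fun x => ?_)
      ?_ ?_ ?_ ?_ ?_ ?_ ?_ ?_ ?_ ?_⟩
    · obtain ⟨k, l, m, n, o, rfl⟩ := gen' x
      exact ⟨k, l, m, o / p, n, by match_scalars <;> field_simp⟩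
    all_goals simp [tableCombo, tableVec, e, hz, hz', hac, hab', hbc', had', hbd', hcd', h]
  · refine ⟨.L55, isomorphic_of_products hF hs h5 _ a b' c ((p / w) • d') (p • z) (fun x => ?_)
      ?_ ?_ ?_ ?_ ?_ ?_ ?_ ?_ ?_ ?_⟩
    · obtain ⟨k, l, m, n, o, rfl⟩ := gen' x
      exact ⟨k, l, m, n * w / p, o / p, by match_scalars <;> field_simp⟩
    all_goals
      simp [tableCombo, tableVec, e, hz', hac, hab', hbc', had', hbd', hcd', smul_smul, h]

theorem inTable_of_heisenberg {a b d z : A} {p q r s t : F} (hF : ringChar F ≠ 2)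
    (h5 : Module.finrank F A = 5) (hs : IsAnticommutative μ)
    (hz : ∀ x, μ z x = 0) (hz' : ∀ x, μ x z = 0)
    (gen : ∀ x, ∃ r s t u v : F, x = r • a + s • b + t • μ a b + u • d + v • z)
    (hac : μ a (μ a b) = p • z) (hbc : μ b (μ a b) = q • z) (had : μ a d = r • z)
    (hbd : μ b d = s • z) (hcd : μ (μ a b) d = t • z) : InTable μ := by
  by_cases ht : t ≠ 0
  · exact inTable_of_M51 hF h5 hs hz hz' gen hac hbc had hbd hcd ht
  rw [not_not] at ht
  rw [ht, zero_smul] at hcd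
  by_cases hp : p ≠ 0
  · exact inTable_of_L53_L55 hF h5 hs hz hz' gen hac hbc had hbd hcd hp
  -- The substitution `(a, b) ↦ (b, -a)` reduces the cases `q ≠ 0` and `s ≠ 0` to those of `p` and
  -- `r`.
  have hc : μ b (-a) = μ a b := by rw [map_neg, hs a b]
  have hneg : ∀ {x y : A} {k : F}, μ x y = k • z → μ (-x) y = (-k) • z := fun h => by
    rw [map_neg, LinearMap.neg_apply, h, neg_smul]
  have gen' : ∀ x, ∃ r s t u v : F, x = r • b + s • -a + t • μ b (-a) + u • d + v • z := by
    intro x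
    obtain ⟨k, l, m, n, o, rfl⟩ := gen x
    exact ⟨l, -k, m, n, o, by rw [hc]; module⟩
  rw [not_not] at hp
  by_cases hq : q ≠ 0
  · exact inTable_of_L53_L55 hF h5 hs hz hz' gen' (hc ▸ hbc) (hc ▸ hneg hac) hbd (hneg had)
      (hc ▸ hcd) hq
  rw [not_not] at hq
  rw [hp, zero_smul] at hac
  rw [hq, zero_smul] at hbc
  by_cases hr : r ≠ 0
  · exact inTable_of_L58 hF h5 hs hz' gen hac hbc had hbd hcd hr
  by_cases hs0 : s ≠ 0
  · exact inTable_of_L58 hF h5 hs hz' gen' (hc ▸ hbc)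
      (by rw [hc, map_neg, LinearMap.neg_apply, hac, neg_zero]) hbd (hneg had) (hc ▸ hcd) hs0
  rw [not_not] at hr hs0
  refine ⟨.L52, isomorphic_of_products hF hs h5 _ a b (μ a b) d z gen
      ?_ ?_ ?_ ?_ ?_ ?_ ?_ ?_ ?_ ?_⟩ <;>
    simp [tableCombo, tableVec, e, hz', hac, hbc, had, hbd, hcd, hr, hs0]

theorem inTable_of_filiform {a b z : A} {p q r t : F} (hF : ringChar F ≠ 2)
    (h5 : Module.finrank F A = 5) (hBL : IsBinaryLie μ) (hz : ∀ x, μ z x = 0)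
    (hz' : ∀ x, μ x z = 0)
    (gen : ∀ x, ∃ r s t u v : F,
      x = r • a + s • b + t • μ a b + u • μ a (μ a b) + v • z)
    (had : μ a (μ a (μ a b)) = p • z) (hbc : μ b (μ a b) = q • z)
    (hbd : μ b (μ a (μ a b)) = r • z) (hcd : μ (μ a b) (μ a (μ a b)) = t • z) :
    InTable μ := by
  have hs := hBL.1
  have h0 := hs.self_eq_zero hF
  generalize hab : μ a b = c at gen had hbc hbd hcd
  generalize hac : μ a c = d at gen had hbd hcd
  have hca : μ c a = -d := by rw [hs, hac]
  have hcb := hs.smul_swap hbc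
  have hda := hs.smul_swap had
  have hdb := hs.smul_swap hbd
  have hdc := hs.smul_swap hcd
  -- With `c = [a,b]` and `d = [a,c]`, the Jacobian `J([a,b],a,b)` reduces to `[b,d]`.
  have hbd0 : r • z = 0 := by
    have := hBL.2 a b
    simpa [jacobian, hab, h0, hca, hbc, hz, hdb] using this
  -- Replacing `b` by `b + c` in the same identity gives `[b,d] + [c,d] = 0`.
  have hcd0 : t • z = 0 := by
    have := hBL.2 a (b + c)
    simpa [jacobian, hab, hac, h0, hca, hcb, hbc, hz, hz', hda, hdb, hdc, hcd, hbd, hbd0] using this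
  rw [hbd0] at hbd
  rw [hcd0] at hcd
  by_cases hp : p = 0
  · by_cases hq : q = 0
    · refine ⟨.L53, isomorphic_of_products hF hs h5 _ a b c d z gen
        ?_ ?_ ?_ ?_ ?_ ?_ ?_ ?_ ?_ ?_⟩ <;>
      simp [tableCombo, tableVec, e, hz', hab, hac, hbc, had, hbd, hcd, hp, hq]
    · refine ⟨.L59, isomorphic_of_products hF hs h5 _ a b c d (q • z) (fun x => ?_)
        ?_ ?_ ?_ ?_ ?_ ?_ ?_ ?_ ?_ ?_⟩
      · obtain ⟨k, l, m, n, o, rfl⟩ := gen x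
        exact ⟨k, l, m, n, o / q, by match_scalars <;> field_simp⟩
      all_goals simp [tableCombo, tableVec, e, hz', hab, hac, hbc, had, hbd, hcd, hp]
  · by_cases hq : q = 0
    · refine ⟨.L57, isomorphic_of_products hF hs h5 _ a b c d (p • z) (fun x => ?_)
        ?_ ?_ ?_ ?_ ?_ ?_ ?_ ?_ ?_ ?_⟩
      · obtain ⟨k, l, m, n, o, rfl⟩ := gen x
        exact ⟨k, l, m, n, o / p, by match_scalars <;> field_simp⟩
      all_goals simp [tableCombo, tableVec, e, hz', hab, hac, hbc, had, hbd, hcd, hq]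
    -- Scaling `b`, `c`, `d` by `λ` turns `[a,d]` into `λp • z` and `[b,c]` into `λ²q • z`; they
    -- agree for `λ = p / q`.
    · refine ⟨.L56, isomorphic_of_products hF hs h5 _ a ((p / q) • b) ((p / q) • c)
        ((p / q) • d) ((p / q * p) • z) (fun x => ?_) ?_ ?_ ?_ ?_ ?_ ?_ ?_ ?_ ?_ ?_⟩
      · obtain ⟨k, l, m, n, o, rfl⟩ := gen x
        exact ⟨k, l * q / p, m * q / p, n * q / p, o * q / p / p,
          by match_scalars <;> field_simp⟩
      all_goals simp [tableCombo, tableVec, e, hz', hab, hac, hbc, had, hbd, hcd, smul_smul]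
      all_goals first | done | (match_scalars; field_simp)

theorem inTable_of_nilpotent (hF : ringChar F ≠ 2) (h5 : Module.finrank F A = 5)
    (hBL : IsBinaryLie μ) (hnil : IsNilpotentAlg μ) : InTable μ := by
  have hfin : FiniteDimensional F A := Module.finite_of_finrank_pos (by omega)
  have hs := hBL.1
  obtain ⟨n, hn⟩ := hnil.exists_leftNil
  obtain ⟨z, hz, hz', hQ, ν, hν, hνs, hνn⟩ := exists_central_quotient h5 hs hn
  obtain ⟨a, b, c, d, gen, had, hbc, hbd, hcd, h⟩ := isNormalFour hF hQ hνs hνn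
  obtain ⟨a, rfl⟩ := Submodule.Quotient.mk_surjective _ a
  obtain ⟨b, rfl⟩ := Submodule.Quotient.mk_surjective _ b
  -- The lifts are left free so that `[a,b]` and `[a,[a,b]]` themselves can be taken where the
  -- quotient has these products, with no correction along `z`.
  have hlift : ∀ c' d' : A, Submodule.Quotient.mk c' = c → Submodule.Quotient.mk d' = d →
      (∀ x, ∃ r s t u v : F, x = r • a + s • b + t • c' + u • d' + v • z) ∧
      (∃ q : F, μ a d' = q • z) ∧ (∃ q : F, μ b c' = q • z) ∧ (∃ q : F, μ b d' = q • z) ∧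
      ∃ r : F, μ c' d' = r • z := by
    rintro c d rfl rfl
    rw [hν] at had hbc hbd hcd
    refine ⟨fun x => ?_, exists_smul_of_mk_eq_zero had, exists_smul_of_mk_eq_zero hbc,
      exists_smul_of_mk_eq_zero hbd, exists_smul_of_mk_eq_zero hcd⟩
    obtain ⟨r, s, t, u, h⟩ := gen (Submodule.Quotient.mk x)
    obtain ⟨v, h⟩ := exists_smul_of_mk_eq (y := r • a + s • b + t • c + u • d) h
    exact ⟨r, s, t, u, v, h⟩
  rw [hν] at h
  rcases h with ⟨hab, hac⟩ | ⟨rfl, hac⟩ | ⟨rfl, rfl⟩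
  · obtain ⟨c, rfl⟩ := Submodule.Quotient.mk_surjective _ c
    obtain ⟨d, rfl⟩ := Submodule.Quotient.mk_surjective _ d
    obtain ⟨gen', ⟨p₃, had'⟩, ⟨p₄, hbc'⟩, ⟨p₅, hbd'⟩, p₆, hcd'⟩ := hlift c d rfl rfl
    rw [hν] at hac
    obtain ⟨p₁, hab'⟩ := exists_smul_of_mk_eq_zero hab
    obtain ⟨p₂, hac'⟩ := exists_smul_of_mk_eq_zero hac
    by_cases h1 : p₁ ≠ 0
    · exact inTable_of_abelian hF h5 hs hz hz' gen' hab' hac' had' hbc' hbd' hcd' h1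
    by_cases h2 : p₂ ≠ 0
    · refine inTable_of_abelian (a := a) (b := c) (c := b) (d := d) hF h5 hs hz hz' (fun x => ?_)
        hac' hab' had' (hs.smul_swap hbc') hcd' hbd' h2
      obtain ⟨k, l, m, n, o, rfl⟩ := gen' x
      exact ⟨k, m, l, n, o, by module⟩
    by_cases h3 : p₃ ≠ 0
    · refine inTable_of_abelian (a := a) (b := d) (c := b) (d := c) hF h5 hs hz hz' (fun x => ?_)
        had' hab' hac' (hs.smul_swap hbd') (hs.smul_swap hcd') hbc' h3
      obtain ⟨k, l, m, n, o, rfl⟩ := gen' x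
      exact ⟨k, n, l, m, o, by module⟩
    by_cases h4 : p₄ ≠ 0
    · refine inTable_of_abelian (a := b) (b := c) (c := a) (d := d) hF h5 hs hz hz' (fun x => ?_)
        hbc' (hs.smul_swap hab') hbd' (hs.smul_swap hac') hcd' had' h4
      obtain ⟨k, l, m, n, o, rfl⟩ := gen' x
      exact ⟨l, m, k, n, o, by module⟩
    by_cases h5' : p₅ ≠ 0
    · refine inTable_of_abelian (a := b) (b := d) (c := a) (d := c) hF h5 hs hz hz' (fun x => ?_)
        hbd' (hs.smul_swap hab') hbc' (hs.smul_swap had') (hs.smul_swap hcd') hac' h5'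
      obtain ⟨k, l, m, n, o, rfl⟩ := gen' x
      exact ⟨l, n, k, m, o, by module⟩
    by_cases h6 : p₆ ≠ 0
    · refine inTable_of_abelian (a := c) (b := d) (c := a) (d := b) hF h5 hs hz hz' (fun x => ?_)
        hcd' (hs.smul_swap hac') (hs.smul_swap hbc') (hs.smul_swap had') (hs.smul_swap hbd') hab'
        h6
      obtain ⟨k, l, m, n, o, rfl⟩ := gen' x
      exact ⟨m, n, k, l, o, by module⟩
    rw [not_not] at h1 h2 h3 h4 h5' h6
    refine ⟨.L51, isomorphic_of_products hF hs h5 _ a b c d z gen'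
      ?_ ?_ ?_ ?_ ?_ ?_ ?_ ?_ ?_ ?_⟩ <;> simp [tableCombo, tableVec, *]
  · obtain ⟨d, rfl⟩ := Submodule.Quotient.mk_surjective _ d
    obtain ⟨gen', ⟨r, had'⟩, ⟨q, hbc'⟩, ⟨s, hbd'⟩, t, hcd'⟩ := hlift (μ a b) d rfl rfl
    rw [hν] at hac
    obtain ⟨p, hac'⟩ := exists_smul_of_mk_eq_zero hac
    exact inTable_of_heisenberg hF h5 hs hz hz' gen' hac' hbc' had' hbd' hcd'
  · obtain ⟨gen', ⟨r, had'⟩, ⟨q, hbc'⟩, ⟨s, hbd'⟩, t, hcd'⟩ :=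
      hlift (μ a b) (μ a (μ a b)) rfl (hν a (μ a b)).symm
    exact inTable_of_filiform hF h5 hBL hz hz' gen' had' hbc' hbd' hcd'

end Classification

end NilpBL

theorem mainTheorem4 (F : Type*) [Field F] (hF : ringChar F ≠ 2) :
    -- every nilpotent binary Lie algebra of dimension 5 is Malcev and is isomorphic to exactly
    -- one algebra of the table
    (∀ (A : Type*) [AddCommGroup A] [Module F A] (μ : A →ₗ[F] A →ₗ[F] A),
      Module.finrank F A = 5 → NilpBL.IsBinaryLie μ → NilpBL.IsNilpotentAlg μ →
        NilpBL.IsMalcev μ ∧ ∃! t : NilpBL.Name, NilpBL.Isomorphic μ (NilpBL.table F t)) ∧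
    -- the algebras of the table are nilpotent Malcev algebras, Lie except for the last one
    (∀ t : NilpBL.Name, NilpBL.IsNilpotentAlg (NilpBL.table F t) ∧
      NilpBL.IsMalcev (NilpBL.table F t) ∧ NilpBL.IsBinaryLie (NilpBL.table F t) ∧
      (NilpBL.IsLie (NilpBL.table F t) ↔ t ≠ .M51)) ∧
    -- they are pairwise nonisomorphic
    (∀ s t : NilpBL.Name, NilpBL.Isomorphic (NilpBL.table F s) (NilpBL.table F t) → s = t) ∧
    -- coboundaries are cocycles, and the second Malcev cohomology spaces are as listed
    (∀ t : NilpBL.Name, NilpBL.B2 (NilpBL.table F t) ≤ NilpBL.ZM (NilpBL.table F t) ∧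
      NilpBL.IsClassBasis (NilpBL.table F t) (NilpBL.tableH2M F t)
        (NilpBL.H2M (NilpBL.table F t))) ∧
    -- the second binary Lie cohomology spaces are as listed
    (∀ t : NilpBL.Name, t ≠ .L58 → t ≠ .M51 → NilpBL.H2M (NilpBL.table F t) = ⊤) ∧
    (∀ t : NilpBL.Name, t = .L58 ∨ t = .M51 →
      ∃ z : NilpBL.ZBL (NilpBL.table F t),
        (z : (Fin 5 → F) →ₗ[F] (Fin 5 → F) →ₗ[F] F) = NilpBL.delta F 3 4 ∧
        NilpBL.cls (NilpBL.table F t) z ≠ 0 ∧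
        IsCompl (NilpBL.H2M (NilpBL.table F t))
          (Submodule.span F {NilpBL.cls (NilpBL.table F t) z})) ∧
    -- the annihilators are as listed
    (∀ t : NilpBL.Name, NilpBL.Ann (NilpBL.table F t) = NilpBL.tableAnn F t) ∧
    -- the sets `U_1`
    (∀ t : NilpBL.Name, (NilpBL.U (NilpBL.table F t) 1).Nonempty ↔ t = .L58 ∨ t = .M51) := by
  exact ⟨fun A _ _ μ h5 hBL hnil => by
      obtain ⟨t, ht⟩ := NilpBL.inTable_of_nilpotent hF h5 hBL hnil
      exact ⟨ht.isMalcev (NilpBL.table_isMalcev F t), t, ht,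
        fun s hs => NilpBL.eq_of_isomorphic (hs.symm.trans ht)⟩,
    fun t => ⟨NilpBL.table_isNilpotent F t, NilpBL.table_isMalcev F t,
      NilpBL.table_isBinaryLie F t,
      fun h ht => NilpBL.table_M51_not_isLie F (ht ▸ h), NilpBL.table_isLie F t⟩,
    fun s t => NilpBL.eq_of_isomorphic,
    fun t => ⟨NilpBL.B2_le_ZM_table hF t, NilpBL.isClassBasis_table hF t⟩,
    NilpBL.H2M_table_eq_top hF, NilpBL.isCompl_H2M hF, NilpBL.Ann_table,
    NilpBL.U_nonempty_iff hF⟩
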